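/- **Setting.** Let $\mathbf t=\{t_1,t_2,\dots\}$, $\bar{\mathbf t}=\{\bar t_1,\bar t_2,\dots\}$ be formal variables (the bar is not complex conjugation), $\partial_0=\partial/\partial t_0$, $\partial_k=\partial/\partial t_k$, $\bar\partial_k=\partial/\partial\bar t_k$, $D(z)=\sum_{k\ge1}\frac{z^{-k}}k\partial_k$, $\bar D(z)=\sum_{k\ge1}\frac{z^{-k}}k\bar\partial_k$. For a Young diagram $\Delta=[\mu_1\ge\dots\ge\mu_\ell>0]$ put $|\Delta|=\sum_i\mu_i$, $\ell(\Delta)=\ell$, $t_\Delta=t_{\mu_1}\cdots t_{\mu_\ell}$, $\bar t_\Delta=\bar t_{\mu_1}\cdots\bar t_{\mu_\ell}$, and $\sigma(\Delta)=\prod_k m_k!$, where $m_k$ is the number of rows of length $k$. A *formal solution* of the dispersionless 2D Toda hierarchy is a formal series $F=\sum_{\Delta,\bar\Delta}F(\Delta|\bar\Delta|t_0)\,t_\Delta\bar t_{\bar\Delta}$ (over all pairs of Young diagrams, including empty ones), whose coefficients are smooth functions of $t_0$ on an open set (real- or complex-valued functions of a real variable, or holomorphic functions of a complex variable), that satisfies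 identically in $z^{-1},\xi^{-1}$ $$(z-\xi)e^{D(z)D(\xi)F}=z\,e^{-\partial_0D(z)F}-\xi\,e^{-\partial_0D(\xi)F},\qquad (z-\xi)e^{\bar D(z)\bar D(\xi)F}=z\,e^{-\partial_0\bar D(z)F}-\xi\,e^{-\partial_0\bar D(\xi)F},$$ $$1-e^{-D(z)\bar D(\xi)F}=\frac1{z\xi}\,e^{\partial_0(\partial_0+D(z)+\bar D(\xi))F}.$$ It is *symmetric* if $\partial_kF=\bar\partial_kF=0$ for all $k\ge1$ on the line $\mathbf t=\bar{\mathbf t}=0$. **Constants.** Let $P_{ij}(r_1,\dots,r_m)$ be the number of pairs of sequences of positive integers $(i_1,\dots,i_m)$, $(j_1,\dots,j_m)$ with $\sum_a i_a=i$, $\sum_a j_a=j$, $i_a+j_a=r_a$. Put $$T_{ij}(p_1,\dots,p_m)=\sum_{k>0,\ n_a>0,\ n_1+\dots+n_k=m}\frac{(-1)^{m+1}}{k\,n_1!\cdots n_k!}\,P_{ij}\Bigl(\sum_{a=1}^{n_1}p_a,\ \sum_{a=n_1+1}^{n_1+n_2}p_a,\ \dots,\ \sum_{a=n_1+\dots+n_{k-1}+1}^{m}p_a\Bigr).$$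 Define $T_{i_1\dots i_k}\binom{s_1\dots s_m}{\ell_1\dots\ell_m}$ by recursion on $k$. For $k=1$, $T_{i_1}\binom{i_1}{0}=1$ and $T_{i_1}$ is $0$ at all other arguments. For $k=2$, it is $T_{i_1i_2}(s_1,\dots,s_m)$ if all $\ell_a=1$, and $0$ otherwise. For $k\ge3$, $$T_{i_1\dots i_k}\binom{s_1\dots s_m}{\ell_1\dots\ell_m}=\sum_{1\le i\le j\le m}\frac{\ell!}{(\ell_i-1)!\cdots(\ell_j-1)!}\;T_{i_1\dots i_{k-1}}\binom{s_1\dots s_{i-1}\;s\;s_{j+1}\dots s_m}{\ell_1\dots\ell_{i-1}\;\ell\;\ell_{j+1}\dots\ell_m}\;T_{s,i_k}(s_i,\dots,s_j),$$ where $s=s_i+\dots+s_j-i_k$, $\ell=(\ell_i-1)+\dots+(\ell_j-1)$, and only the terms with $s>0$, $\ell>0$, $\ell_i,\dots,\ell_j\ge1$ are taken. Put $$\tilde N_{\binom{i_1\dots i_k}{\bar i_1\dots\bar i_{\bar k}}}\binom{s_1\dots s_m}{r_1\dots r_m}=\frac{i_1\cdots i_k\,\bar i_1\cdots\bar i_{\bar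 k}}{s_1\cdots s_m}\sum T_{i_1\dots i_k}\binom{s_1\ \dots\ s_m}{r_1-n_1+1\ \dots\ r_m-n_m+1},$$ the sum being over all ways to distribute the indices $1,\dots,\bar k$ into $m$ labelled non-empty blocks such that the numbers $\bar i_b$ with $b$ in the $a$-th block have sum $s_a$, for $a=1,\dots,m$; $n_a$ is the number of elements of the $a$-th block, and terms with some $r_a-n_a+1<0$ are $0$. Finally, for $\Delta=[\mu_1\ge\dots\ge\mu_k]$ and $\bar\Delta=[\bar\mu_1\ge\dots\ge\bar\mu_{\bar k}]$, $$N_{(\Delta|\bar\Delta)}\binom{s_1\dots s_m}{r_1\dots r_m}=\frac1{\sigma(\Delta)\sigma(\bar\Delta)}\,\tilde N_{\binom{\mu_1\dots\mu_k}{\bar\mu_1\dots\bar\mu_{\bar k}}}\binom{s_1\dots s_m}{r_1\dots r_m}.$$ **Theorem.** Every symmetric formal solution $F$ of the dispersionless 2D Toda hierarchy has the form $$F=F(t_0)+\sum_{|\Delta|=|\bar\Delta|>0}\ \ \sum_{\substack{s_1+\dots+s_m=|\Delta|\\ r_1+\dots+r_m=\ell(\Delta)+\ell(\bar\Delta)-2}}N_{(\Delta|\bar\Delta)}\binom{s_1\dots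 s_m}{r_1\dots r_m}\,\partial_0^{r_1}(f^{s_1})\cdots\partial_0^{r_m}(f^{s_m})\;t_\Delta\bar t_{\bar\Delta},$$ where $F(t_0)=F(\emptyset|\emptyset|t_0)$, $f(t_0)=\exp(F''(t_0))$, and the inner sum is over all $m\ge1$, all positive integers $s_a$ and all integers $r_a\ge0$ satisfying the two conditions. In particular, two symmetric formal solutions (over the same open set) with the same function $F(t_0)$ coincide. -/

import Mathlib

open scoped ContDiff

namespace Toda

/-! ### Combinatorial constants -/

/-- `P i j r` for `r = (r₁, …, r_m)`: the number of pairs of sequences of positive integers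
`(i₁, …, i_m)`, `(j₁, …, j_m)` with `∑ i_a = i`, `∑ j_a = j` and `i_a + j_a = r_a` for all `a`. -/
def P (i j : ℕ) (r : List ℕ) : ℕ :=
  ((Finset.Nat.antidiagonalTuple r.length i ×ˢ Finset.Nat.antidiagonalTuple r.length j).filter
    fun ab => ∀ a, 0 < ab.1 a ∧ 0 < ab.2 a ∧ ab.1 a + ab.2 a = r.get a).card

/-- `T₂ i j p` is the constant `T_{ij}(p₁, …, p_m)`: the sum runs over the ways
`c = (n₁, …, n_k)` of cutting `(p₁, …, p_m)` into `k` consecutive non-empty blocks of lengths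
`n₁, …, n_k`, and `P i j` is applied to the sequence of the sums of the blocks. -/
def T₂ (i j : ℕ) (p : List ℕ) : ℚ :=
  ∑ c : Composition p.length,
    (-1 : ℚ) ^ (p.length + 1) / (c.length * (c.blocks.map Nat.factorial).prod : ℕ) *
      P i j ((p.splitWrtComposition c).map List.sum)

/-- The constants `T_{i₁ … i_k}` at a list of columns `(s₁, ℓ₁), …, (s_m, ℓ_m)`; the list of lower
indices is written here in the *reversed* order `i_k, …, i₁`.
* For `k = 1` it is `1` at the single column `(i₁, 0)` and `0` elsewhere
  (this is the tautology `∂_{i₁} F = ∂_{i₁} F`).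
* For `k = 2` it is `T_{i₁ i₂}(s₁, …, s_m)` if all `ℓ_a` are `1`, and `0` otherwise.
* For `k ≥ 3` the list of columns is cut in all possible ways into an initial part (the first `a`
  columns), a non-empty middle block `B` (the columns `a + 1, …, b`), and a final part; the block
  is replaced by the one column `(s, ℓ)`, where `s = ∑_B s_q - i_k` and `ℓ = ∑_B (ℓ_q - 1)`. Only
  the terms in which `s`, `ℓ` and the `ℓ_q` of the block are positive occur. -/
def TRev : List ℕ → List (ℕ × ℕ) → ℚ
  | [], _ => 0
  | [i], cols => if cols = [(i, 0)] then 1 else 0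
  | [j, i], cols => if ∀ q ∈ cols, q.2 = 1 then T₂ i j (cols.map Prod.fst) else 0
  | ik :: i :: i' :: is, cols =>
    ∑ b ∈ Finset.range (cols.length + 1), ∑ a ∈ Finset.range b,
      let B := (cols.take b).drop a
      let s := (B.map Prod.fst).sum - ik
      let l := (B.map fun q => q.2 - 1).sum
      if ik < (B.map Prod.fst).sum ∧ 0 < l ∧ ∀ q ∈ B, 1 ≤ q.2 then
        (l.factorial : ℚ) / ((B.map fun q => (q.2 - 1).factorial).prod : ℕ) *
          TRev (i :: i' :: is) (cols.take a ++ (s, l) :: cols.drop b) *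
          T₂ s ik (B.map Prod.fst)
      else 0

/-- `T [i₁, …, i_k] [(s₁, ℓ₁), …, (s_m, ℓ_m)]`. -/
def T (I : List ℕ) (cols : List (ℕ × ℕ)) : ℚ := TRev I.reverse cols

/-- The constant `Ñ` for lower indices `I = (i₁, …, i_k)`, `J = (j₁, …, j_n)` (the barred ones)
and columns `(s_a, r_a)`, `a < m`. The sum is over all ways of distributing the (positions of the)
members of `J` into `m` non-empty blocks, the `a`-th of which has sum `s_a`; `n_a` is the number of
members of the `a`-th block. The constant `T` is understood to be `0` if one of the numbers
`r_a - n_a + 1` is negative. -/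
def NTilde (I J : List ℕ) {m : ℕ} (s r : Fin m → ℕ) : ℚ :=
  (I.prod * J.prod : ℕ) / (∏ a, s a : ℕ) *
    ∑ g : Fin J.length → Fin m,
      let n : Fin m → ℕ := fun a => (Finset.univ.filter fun b => g b = a).card
      if (∀ a, 0 < n a) ∧ (∀ a, ∑ b ∈ Finset.univ.filter (fun b => g b = a), J.get b = s a) ∧
          ∀ a, n a ≤ r a + 1 then
        T I (List.ofFn fun a => (s a, r a + 1 - n a))
      else 0

/-! ### Young diagrams

A Young diagram is given by the multiset of the (positive) lengths of its rows. The number of rows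
`ℓ(Δ)` is `Multiset.card Δ`. -/

/-- The lengths of the rows in weakly decreasing order. -/
def rows (Δ : Multiset ℕ+) : List ℕ := (Δ.sort (· ≥ ·)).map fun k => (k : ℕ)

/-- The number of cells `|Δ|`. -/
def size (Δ : Multiset ℕ+) : ℕ := (Δ.map fun k => (k : ℕ)).sum

/-- `σ(Δ) = m₁! m₂! ⋯`, where `m_k` is the number of rows of length `k`. -/
def sigma (Δ : Multiset ℕ+) : ℕ := ∏ k ∈ Δ.toFinset, (Δ.count k).factorial

/-- The constants `N_{(Δ|Δ')}`. -/
def N (Δ Δ' : Multiset ℕ+) {m : ℕ} (s r : Fin m → ℕ) : ℚ :=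
  1 / ((sigma Δ : ℚ) * sigma Δ') * NTilde (rows Δ) (rows Δ') s r

/-! ### Formal series in the times and the equations of the hierarchy -/

/-- The times: `Sum.inl k` stands for `t_k` and `Sum.inr k` for `t̄_k`, `k ≥ 1`. -/
abbrev Time := ℕ+ ⊕ ℕ+

section

variable (𝕜 K : Type*) [RCLike 𝕜] [RCLike K] [NormedAlgebra 𝕜 K]

/-- Formal Taylor series in the times whose coefficients are functions of `t₀`. -/
abbrev TimeSeries := MvPowerSeries Time (𝕜 → K)

/-- Formal power series in two further variables, the variable `0` being `z⁻¹` and the variable `1`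
being `ξ⁻¹`, with coefficients in `TimeSeries`. -/
abbrev GenSeries := MvPowerSeries (Fin 2) (TimeSeries 𝕜 K)

end

section

variable {𝕜 K : Type*} [RCLike 𝕜] [RCLike K] [NormedAlgebra 𝕜 K]

/-- `F(Δ|Δ'|t₀)`, the coefficient of `t_Δ t̄_Δ'`. -/
noncomputable def coeffAt (F : TimeSeries 𝕜 K) (Δ Δ' : Multiset ℕ+) : 𝕜 → K :=
  MvPowerSeries.coeff (Multiset.toFinsupp (Δ.map Sum.inl + Δ'.map Sum.inr)) F

/-- `∂₀ = ∂/∂t₀`, coefficient by coefficient. -/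
noncomputable def d0 (F : TimeSeries 𝕜 K) : TimeSeries 𝕜 K :=
  fun n => deriv (MvPowerSeries.coeff n F)

/-- `∂_k` (for `τ = Sum.inl k`) and `∂̄_k` (for `τ = Sum.inr k`). -/
noncomputable def dt (τ : Time) (F : TimeSeries 𝕜 K) : TimeSeries 𝕜 K :=
  MvPowerSeries.pderiv (𝕜 → K) τ F

/-- `∂₀` on series in `z⁻¹`, `ξ⁻¹`. -/
noncomputable def genD0 (G : GenSeries 𝕜 K) : GenSeries 𝕜 K :=
  fun n => d0 (MvPowerSeries.coeff n G)

/-- The operator `∑_{k ≥ 1} (w^k / k) ∂_{time k}`, where `w` is the variable number `a`: this is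
`D(z)`, `D(ξ)` for `time = Sum.inl`, `a = 0, 1`, and `D̄` for `time = Sum.inr`. -/
noncomputable def genD (time : ℕ+ → Time) (a : Fin 2) (G : GenSeries 𝕜 K) : GenSeries 𝕜 K :=
  fun n => ∑ k : Fin (n a), ((k : ℚ) + 1)⁻¹ •
    dt (time (Nat.succPNat k)) (MvPowerSeries.coeff (n - Finsupp.single a ((k : ℕ) + 1)) G)

/-- The value of a series at the point `x` of the `t₀`-line. -/
noncomputable def evalAt (x : 𝕜) (G : GenSeries 𝕜 K) :
    MvPowerSeries (Fin 2) (MvPowerSeries Time K) :=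
  MvPowerSeries.map (MvPowerSeries.map (Pi.evalRingHom (fun _ : 𝕜 => K) x)) G

end

/-- The exponential of a formal power series `G` with constant term `c`, relative to an exponential
function `e` on the coefficient ring: `e(c) · ∑_n (G - c)ⁿ / n!`. -/
noncomputable def expWith {σ R : Type*} [CommRing R] [Algebra ℚ R] (e : R → R)
    (G : MvPowerSeries σ R) : MvPowerSeries σ R :=
  MvPowerSeries.C (e (MvPowerSeries.constantCoeff G)) *
    (PowerSeries.exp ℚ).subst (G - MvPowerSeries.C (MvPowerSeries.constantCoeff G))

/-- The exponential of a power series in `z⁻¹`, `ξ⁻¹` over power series in the times. -/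
noncomputable def gexp {K : Type*} [RCLike K] (G : MvPowerSeries (Fin 2) (MvPowerSeries Time K)) :
    MvPowerSeries (Fin 2) (MvPowerSeries Time K) :=
  expWith (expWith NormedSpace.exp) G

section

variable {𝕜 K : Type*} [RCLike 𝕜] [RCLike K] [NormedAlgebra 𝕜 K]

/-- The equation
`(z - ξ) exp(D(z) D(ξ) F) = z exp(-∂₀ D(z) F) - ξ exp(-∂₀ D(ξ) F)`
at the point `x` of the `t₀`-line (for `time = Sum.inl`; for `time = Sum.inr` its barred
counterpart). Both sides are multiplied by `z⁻¹ ξ⁻¹`. -/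
def HirotaEq (time : ℕ+ → Time) (F : TimeSeries 𝕜 K) (x : 𝕜) : Prop :=
  let Φ : GenSeries 𝕜 K := MvPowerSeries.C F
  (MvPowerSeries.X 1 - MvPowerSeries.X 0) * gexp (evalAt x (genD time 0 (genD time 1 Φ))) =
    MvPowerSeries.X 1 * gexp (evalAt x (-genD0 (genD time 0 Φ))) -
      MvPowerSeries.X 0 * gexp (evalAt x (-genD0 (genD time 1 Φ)))

/-- The equation
`1 - exp(-D(z) D̄(ξ) F) = z⁻¹ ξ⁻¹ exp(∂₀ (∂₀ + D(z) + D̄(ξ)) F)` at the point `x`. -/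
def MixedHirotaEq (F : TimeSeries 𝕜 K) (x : 𝕜) : Prop :=
  let Φ : GenSeries 𝕜 K := MvPowerSeries.C F
  1 - gexp (evalAt x (-genD Sum.inl 0 (genD Sum.inr 1 Φ))) =
    MvPowerSeries.X 0 * MvPowerSeries.X 1 *
      gexp (evalAt x (genD0 (genD0 Φ + genD Sum.inl 0 Φ + genD Sum.inr 1 Φ)))

/-- `F` is a formal solution of the dispersionless 2D Toda hierarchy over the set `U` of values
of `t₀`: its coefficients are smooth functions on `U` and the equations hold identically. -/
def IsFormalSolution (U : Set 𝕜) (F : TimeSeries 𝕜 K) : Prop :=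
  (∀ Δ Δ' : Multiset ℕ+, ContDiffOn 𝕜 ∞ (coeffAt F Δ Δ') U) ∧
    ∀ x ∈ U, HirotaEq Sum.inl F x ∧ HirotaEq Sum.inr F x ∧ MixedHirotaEq F x

/-- A symmetric formal solution: all `∂_k F` and `∂̄_k F` vanish on the line where all the times
`t_k`, `t̄_k` are zero. -/
def IsSymmetricSolution (U : Set 𝕜) (F : TimeSeries 𝕜 K) : Prop :=
  IsFormalSolution U F ∧
    ∀ x ∈ U, ∀ τ : Time, (MvPowerSeries.constantCoeff (dt τ F) : 𝕜 → K) x = 0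

/-- The value at `x` of the sum of
`N_{(Δ|Δ')}(s; r) ∂₀^{r₁}(f^{s₁}) ⋯ ∂₀^{r_m}(f^{s_m})` over all `m`, all sequences of positive
integers `s₁, …, s_m` with sum `|Δ|` (the composition `c`), and all sequences of non-negative
integers `r₁, …, r_m` with sum `ℓ(Δ) + ℓ(Δ') - 2`. -/
noncomputable def taylorCoeff (f : 𝕜 → K) (Δ Δ' : Multiset ℕ+) (x : 𝕜) : K :=
  ∑ c : Composition (size Δ),
    ∑ r ∈ Finset.Nat.antidiagonalTuple c.length (Multiset.card Δ + Multiset.card Δ' - 2),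
      ((N Δ Δ' c.blocksFun r : ℚ) : K) *
        ∏ a, iteratedDeriv (r a) (fun y => f y ^ c.blocksFun a) x

end

end Toda

/-!
The Taylor coefficients of a symmetric formal solution `F` are found by differentiating `F`
repeatedly and restricting to the line where all times vanish. Write `E_i = (1/i) ∂_i` and
`Ē_j = (1/j) ∂̄_j` (in the Lean text `E'_j`), so that `D(z) = ∑ z⁻ⁱ E_i`.

* Unmixed equations. Dividing by `z - ξ` and taking logarithms, the first equation of the hierarchy
  becomes `E_j E_i F = ∑_p T_{ij}(p) ∏_a ∂₀ E_{p_a} F`, the sum over all sequences `p` of positive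
  integers with sum `i + j` (`coeff_eq_of_hirota`, `timeDeriv_timeDeriv_of_hirotaEq`).
* Iteration. Differentiating a product of terms `∂₀^ℓ E_s F` by `E_i` replaces one factor, by the
  Leibniz rule for `∂₀^ℓ`, by a combination of products of the same kind. The coefficients that
  arise are those of the recursion for `T_{i_1 … i_k}`: the columns `(s, ℓ)` name the factors
  (`foldr_eq_sum_TRev`).
* Barred derivatives. Applied to such a product, `Ē_{j_1} ⋯ Ē_{j_n}` distributes the indices among
  the factors. On the line `t = t̄ = 0` a factor that receives no index vanishes by symmetry. A
  factor `∂₀^ℓ E_s F` that receives the indices of a block of size `n` contributes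
  `∂₀^ℓ E_s (Ē ⋯ Ē F)`. In the expansion of `Ē ⋯ Ē F`, only the term with the single column
  `(∑ j_b, n - 1)` has a nonzero derivative by `E_s` on the line, so the contribution is
  `∂₀^{ℓ + n - 1} E_s Ē_{∑ j_b} F`. The logarithm of the mixed equation on the line is
  `D(z) D̄(ξ) F = ∑_k (f / (z ξ))^k / k`, so `E_s Ē_q F` is `f^s / s` if `q = s`, and zero
  otherwise. This is the definition of `Ñ` (`ev_foldr_foldr`).

Two choices keep this algebraic. The argument up to the definition of `Ñ` is about commuting
derivations of commutative `ℚ`-algebras. It is applied to power series in the times over the ring of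
smooth functions on `U`, whose elements have no values outside of `U`; equations that hold at each
point of `U` are then equations in that ring.
-/

namespace Toda

/-! ### Exponentials of multivariate power series -/

section ExpSeries

open MvPowerSeries

variable {σ R : Type*} [CommRing R]

/-- `EqTo N f g` says that the coefficients of `f` and `g` of total degree at most `N` agree. -/
def EqTo (N : ℕ) (f g : MvPowerSeries σ R) : Prop :=
  ∀ e : σ →₀ ℕ, e.degree ≤ N → coeff e f = coeff e g

lemma EqTo.refl (N : ℕ) (f : MvPowerSeries σ R) : EqTo N f f := fun _ _ => rfl

lemma EqTo.mul {N : ℕ} {f g f' g' : MvPowerSeries σ R} (h : EqTo N f g) (h' : EqTo N f' g') :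
    EqTo N (f * f') (g * g') := by
  classical
  intro e he
  rw [coeff_mul, coeff_mul]
  refine Finset.sum_congr rfl fun p hp => ?_
  have : p.1.degree + p.2.degree = e.degree := by
    rw [← Finset.HasAntidiagonal.mem_antidiagonal.1 hp, map_add]
  rw [h _ (by omega), h' _ (by omega)]

lemma EqTo.pow {N : ℕ} {f g : MvPowerSeries σ R} (h : EqTo N f g) (k : ℕ) :
    EqTo N (f ^ k) (g ^ k) := by
  induction k with
  | zero => simpa using EqTo.refl N _
  | succ k ih => simpa only [pow_succ] using ih.mul h

lemma coeff_pow_mul_of_degree_lt {H G : MvPowerSeries σ R} (hH : constantCoeff H = 0) {k : ℕ}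
    {e : σ →₀ ℕ} (he : e.degree < k) : coeff e (H ^ k * G) = 0 := by
  apply coeff_of_lt_order
  calc ((e.degree : ℕ) : ℕ∞) < k := by exact_mod_cast he
    _ ≤ (H ^ k).order := le_order_pow_of_constantCoeff_eq_zero k hH
    _ ≤ (H ^ k).order + G.order := le_self_add
    _ ≤ _ := le_order_mul

lemma coeff_pow_of_degree_lt {H : MvPowerSeries σ R} (hH : constantCoeff H = 0) {k : ℕ}
    {e : σ →₀ ℕ} (he : e.degree < k) : coeff e (H ^ k) = 0 := by
  simpa using coeff_pow_mul_of_degree_lt (G := 1) hH he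

lemma coeff_sum_monomial_pow {ι : Type*} (Λ : Finset ι) (v : ι → σ →₀ ℕ) (w : ι → R) (k : ℕ)
    (e : σ →₀ ℕ) [DecidableEq σ] :
    coeff e ((∑ x ∈ Λ, monomial (v x) (w x)) ^ k) =
      ∑ Q ∈ Fintype.piFinset fun _ : Fin k => Λ,
        if ∑ a, v (Q a) = e then ∏ a, w (Q a) else 0 := by
  have h : (∑ x ∈ Λ, monomial (v x) (w x)) ^ k =
      ∑ Q ∈ Fintype.piFinset fun _ : Fin k => Λ,
        monomial (∑ a, v (Q a)) (∏ a, w (Q a)) := by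
    have : (∑ x ∈ Λ, monomial (v x) (w x)) ^ k =
      ∏ _a : Fin k, ∑ x ∈ Λ, monomial (v x) (w x) := by simp
    rw [this, Finset.prod_univ_sum]
    exact Finset.sum_congr rfl fun Q _ => prod_monomial ..
  rw [h, map_sum]
  refine Finset.sum_congr rfl fun Q _ => ?_
  rw [coeff_monomial]
  simp only [eq_comm]

variable [Algebra ℚ R]

/-- The exponential of a power series without constant term. -/
noncomputable abbrev expSubst (B : MvPowerSeries σ R) : MvPowerSeries σ R :=
  (PowerSeries.exp ℚ).subst B

/-- In degree less than `N` the exponential series is the polynomial `∑_{n < N} Bⁿ / n!`. -/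
lemma coeff_expSubst {B : MvPowerSeries σ R} (hB : constantCoeff B = 0) {N : ℕ} {e : σ →₀ ℕ}
    (he : e.degree < N) :
    coeff e (expSubst B) = ∑ n ∈ Finset.range N, ((n.factorial : ℚ)⁻¹) • coeff e (B ^ n) := by
  rw [PowerSeries.coeff_subst (PowerSeries.HasSubst.of_constantCoeff_zero hB)]
  rw [finsum_eq_sum_of_support_subset (s := Finset.range N)]
  · simp [PowerSeries.coeff_exp]
  · intro n hn
    by_contra h
    simp only [Finset.coe_range, Set.mem_Iio, not_lt] at h
    apply hn
    simp only
    rw [coeff_pow_of_degree_lt hB (by omega), smul_zero]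

lemma eqTo_expSubst {B : MvPowerSeries σ R} (hB : constantCoeff B = 0) {N M : ℕ} (h : N < M) :
    EqTo N (expSubst B) (∑ n ∈ Finset.range M, ((n.factorial : ℚ)⁻¹) • B ^ n) := by
  intro e he
  rw [coeff_expSubst hB (lt_of_le_of_lt he h), map_sum]
  rfl

lemma constantCoeff_expSubst {B : MvPowerSeries σ R} (hB : constantCoeff B = 0) :
    constantCoeff (expSubst B) = 1 := by
  rw [← coeff_zero_eq_constantCoeff_apply, coeff_expSubst hB (N := 1) (by simp)]
  simp

lemma pderiv_smul_rat (i : σ) (q : ℚ) (f : MvPowerSeries σ R) :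
    pderiv R i (q • f) = q • pderiv R i f := by
  rw [algebra_compatible_smul R q f, Derivation.map_smul, ← algebra_compatible_smul]

lemma pderiv_expSubst {B : MvPowerSeries σ R} (hB : constantCoeff B = 0) (i : σ) :
    pderiv R i (expSubst B) = expSubst B * pderiv R i B := by
  ext e
  set N := e.degree with hN
  have h1 := eqTo_expSubst hB (Nat.lt_succ_self N)
  rw [h1.mul (EqTo.refl N _) e le_rfl, coeff_pderiv,
    eqTo_expSubst hB (N := N + 1) (M := N + 2) (by omega) _ (by simp [hN]), ← coeff_pderiv,
    map_sum, Finset.sum_range_succ', Finset.sum_mul, map_add, map_sum, map_sum]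
  simp only [pderiv_smul_rat, Derivation.leibniz_pow, pow_zero, Derivation.map_one_eq_zero,
    smul_zero, map_zero, add_zero]
  refine Finset.sum_congr rfl fun n _ => ?_
  congr 1
  rw [Nat.add_sub_cancel, smul_mul_assoc, smul_eq_mul, ← Nat.cast_smul_eq_nsmul ℚ, smul_smul,
    Nat.factorial_succ]
  congr 1
  push_cast
  field_simp

/-- If `exp B = 1 - H`, where `B` and `H` have no constant term, then
`B = log (1 - H) = -∑_k Hᵏ / k`. -/
theorem coeff_eq_of_expSubst_eq_one_sub {B H : MvPowerSeries σ R} (hB : constantCoeff B = 0)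
    (hH : constantCoeff H = 0) (h : expSubst B = 1 - H) {N : ℕ} {e : σ →₀ ℕ}
    (he : e.degree ≤ N) :
    coeff e B = -∑ k ∈ Finset.range N, ((k : ℚ) + 1)⁻¹ • coeff e (H ^ (k + 1)) := by
  classical
  set L : MvPowerSeries σ R := -∑ k ∈ Finset.range N, ((k : ℚ) + 1)⁻¹ • H ^ (k + 1) with hL
  suffices coeff e B = coeff e L by rw [this, hL, map_neg, map_sum]; rfl
  rcases eq_or_ne e 0 with rfl | he0
  · simp [hL, hB, hH]
  obtain ⟨i, hi⟩ : ∃ i, e i ≠ 0 := by simpa using Finsupp.ne_iff.1 he0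
  obtain ⟨e', rfl⟩ : ∃ e', e = e' + Finsupp.single i 1 :=
    ⟨e - Finsupp.single i 1, by
      ext j; by_cases hj : j = i
      · subst hj; simp; omega
      · simp [Finsupp.single_eq_of_ne hj]⟩
  have hdeg : e'.degree < N := by simpa using he
  -- it suffices to compare one partial derivative, as `e i ≠ 0` is invertible in a `ℚ`-algebra
  have hdB : (1 - H) * pderiv R i B = -pderiv R i H := by
    rw [← h, ← pderiv_expSubst hB, h]; simp
  have hdL : pderiv R i L = -(∑ k ∈ Finset.range N, H ^ k) * pderiv R i H := by
    rw [hL, map_neg, map_sum, neg_mul, Finset.sum_mul]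
    congr 1
    refine Finset.sum_congr rfl fun k _ => ?_
    rw [pderiv_smul_rat, Derivation.leibniz_pow, Nat.add_sub_cancel, smul_eq_mul,
      ← Nat.cast_smul_eq_nsmul ℚ, smul_smul]
    push_cast
    rw [inv_mul_cancel₀ (by positivity), one_smul]
  have hD : (1 - H) * (pderiv R i (B - L)) = -(H ^ N * pderiv R i H) := by
    rw [map_sub, mul_sub, hdB, hdL]
    have := mul_neg_geom_sum H N
    linear_combination (pderiv R i H) * this
  have hunit : IsUnit (1 - H) := by
    rw [isUnit_iff_constantCoeff]; simp [hH]
  obtain ⟨u, hu⟩ := hunit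
  have hD' : pderiv R i (B - L) = H ^ N * (-(pderiv R i H) * ↑u⁻¹) := by
    rw [← hu] at hD
    calc pderiv R i (B - L) = ↑u⁻¹ * (↑u * pderiv R i (B - L)) := by simp
      _ = _ := by rw [hD]; ring
  have hz : coeff e' (pderiv R i (B - L)) = 0 := by
    rw [hD']; exact coeff_pow_mul_of_degree_lt hH hdeg
  rw [coeff_pderiv] at hz
  have hu' : IsUnit ((e' i : R) + 1) := by
    have : ((e' i : R) + 1) = algebraMap ℚ R ((e' i : ℚ) + 1) := by simp
    rw [this]
    exact (IsUnit.mk0 _ (by positivity)).map _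
  have := hu'.mul_left_eq_zero.1 hz
  rwa [map_sub, sub_eq_zero] at this

end ExpSeries

/-! ### Lists of positive numbers and lists of lists -/

section Lists

/-- The lists of positive natural numbers with sum `n`. -/
def posLists (n : ℕ) : Finset (List ℕ) :=
  Finset.univ.map (α := Composition n) ⟨Composition.blocks, fun _ _ h => Composition.ext h⟩

lemma mem_posLists {n : ℕ} {p : List ℕ} : p ∈ posLists n ↔ (∀ x ∈ p, 0 < x) ∧ p.sum = n := by
  simp only [posLists, Finset.mem_map, Finset.mem_univ, true_and]
  constructor
  · rintro ⟨c, rfl⟩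
    exact ⟨fun x hx => c.blocks_pos hx, c.blocks_sum⟩
  · rintro ⟨h, h'⟩
    exact ⟨⟨p, fun hx => h _ hx, h'⟩, rfl⟩

lemma length_le_sum_of_pos {p : List ℕ} (h : ∀ x ∈ p, 0 < x) : p.length ≤ p.sum := by
  induction p with
  | nil => simp
  | cons x p ih =>
    have h1 := h x (by simp)
    have h2 := ih fun y hy => h y (by simp [hy])
    simp only [List.length_cons, List.sum_cons]; omega

/-- The lists of length less than `M` with entries in `Λ`. -/
def listsIn {α : Type*} (Λ : Finset α) (M : ℕ) : Finset (List α) :=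
  ((Finset.range M).sigma fun n => Fintype.piFinset fun _ : Fin n => Λ).map
    List.equivSigmaTuple.symm.toEmbedding

lemma mem_listsIn {α : Type*} {Λ : Finset α} {M : ℕ} {l : List α} :
    l ∈ listsIn Λ M ↔ l.length < M ∧ ∀ x ∈ l, x ∈ Λ := by
  simp only [listsIn, Finset.mem_map_equiv, Equiv.symm_symm, Finset.mem_sigma, Finset.mem_range,
    Fintype.mem_piFinset, List.equivSigmaTuple_apply_fst]
  refine and_congr_right fun _ => ⟨fun h x hx => ?_, fun h a => h _ (List.get_mem _ _)⟩
  obtain ⟨a, rfl⟩ := List.get_of_mem hx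
  exact h a

lemma sum_listsIn {α M : Type*} [AddCommMonoid M] (Λ : Finset α) (N : ℕ) (g : List α → M) :
    ∑ l ∈ listsIn Λ N, g l =
      ∑ n ∈ Finset.range N, ∑ Q ∈ Fintype.piFinset fun _ : Fin n => Λ, g (List.ofFn Q) := by
  rw [listsIn, Finset.sum_map, Finset.sum_sigma]
  rfl

lemma sum_map_sum_flatten (l : List (List ℕ)) : (l.map List.sum).sum = l.flatten.sum := by
  induction l with
  | nil => rfl
  | cons q l ih =>
    simp only [List.map_cons, List.sum_cons, List.flatten_cons, List.sum_append, ih]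

/-- Cutting a list of positive numbers into consecutive non-empty blocks is the same as giving a
list of non-empty lists. -/
lemma sum_posLists_composition {M : Type*} [AddCommMonoid M] (n : ℕ) (Λ : Finset (List ℕ))
    (hΛ : ∀ q, q ∈ Λ ↔ q ≠ [] ∧ (∀ x ∈ q, 0 < x) ∧ q.sum ≤ n) (g : List (List ℕ) → M) :
    ∑ p ∈ posLists n, ∑ c : Composition p.length, g (p.splitWrtComposition c) =
      ∑ l ∈ (listsIn Λ (n + 1)).filter fun l => l.flatten.sum = n, g l := by
  rw [Finset.sum_sigma']
  refine Finset.sum_bij (fun x _ => x.1.splitWrtComposition x.2) ?_ ?_ ?_ fun _ _ => rfl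
  · rintro ⟨p, c⟩ hx
    simp only [Finset.mem_sigma, mem_posLists, Finset.mem_univ, and_true] at hx
    simp only [Finset.mem_filter, mem_listsIn, List.flatten_splitWrtComposition, hx.2, and_true,
      List.length_splitWrtComposition]
    refine ⟨?_, fun q hq => ?_⟩
    · have := c.length_le
      have := length_le_sum_of_pos hx.1
      omega
    · rw [hΛ]
      refine ⟨List.ne_nil_of_length_pos (List.length_pos_of_mem_splitWrtComposition hq), ?_, ?_⟩
      · intro x hx'
        apply hx.1
        rw [← List.flatten_splitWrtComposition p c]
        exact List.mem_flatten.2 ⟨q, hq, hx'⟩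
      · rw [← hx.2]
        conv_rhs => rw [← List.flatten_splitWrtComposition p c, ← sum_map_sum_flatten]
        exact List.le_sum_of_mem (List.mem_map_of_mem hq)
  · rintro ⟨p, c⟩ _ ⟨p', c'⟩ _ h
    have hp : p = p' := by
      simpa using congrArg List.flatten h
    subst hp
    congr 1
    apply Composition.ext
    simpa only [List.map_length_splitWrtComposition] using congrArg (List.map List.length) h
  · intro l hl
    simp only [Finset.mem_filter, mem_listsIn, hΛ] at hl
    have hc : ∀ {k}, k ∈ l.map List.length → 0 < k := by
      intro k hk
      obtain ⟨q, hq, rfl⟩ := List.mem_map.1 hk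
      exact List.length_pos_of_ne_nil (hl.1.2 q hq).1
    refine ⟨⟨l.flatten, ⟨l.map List.length, hc, List.length_flatten.symm⟩⟩, ?_, ?_⟩
    · simp only [Finset.mem_sigma, mem_posLists, Finset.mem_univ, and_true]
      refine ⟨fun x hx => ?_, hl.2⟩
      obtain ⟨q, hq, hx⟩ := List.mem_flatten.1 hx
      exact (hl.1.2 q hq).2.1 x hx
    · exact List.splitWrtComposition_flatten _ _ rfl

lemma P_eq_zero {i j : ℕ} {r : List ℕ} (h : r.sum ≠ i + j) : P i j r = 0 := by
  rw [P, Finset.card_eq_zero, Finset.filter_eq_empty_iff]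
  rintro ⟨a, b⟩ hab hpos
  simp only [Finset.mem_product, Finset.Nat.mem_antidiagonalTuple] at hab
  apply h
  rw [← hab.1, ← hab.2, ← Finset.sum_add_distrib, Finset.sum_congr rfl fun x _ => (hpos x).2.2,
    ← List.sum_ofFn, List.ofFn_get]

lemma T₂_eq_zero {i j : ℕ} {p : List ℕ} (h : p.sum ≠ i + j) : T₂ i j p = 0 := by
  rw [T₂]
  refine Finset.sum_eq_zero fun c _ => ?_
  rw [P_eq_zero, Nat.cast_zero, mul_zero]
  rwa [sum_map_sum_flatten, List.flatten_splitWrtComposition]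

lemma T₂_nil (i j : ℕ) : T₂ i j [] = 0 := by
  rw [T₂]
  refine Finset.sum_eq_zero fun c _ => ?_
  have : c.length = 0 := Nat.le_zero.1 c.length_le
  simp [this]

end Lists

/-! ### The constants `T₂` solve the Hirota equation -/

section Hirota

open MvPowerSeries

variable {R : Type*} [CommRing R] [Algebra ℚ R]

/-- The monomial `(-1)ⁿ / n! · a_{q₁} ⋯ a_{q_n}` of `exp (-∑ a_p uᵖ)`. -/
noncomputable def expTerm (a : ℕ → R) (q : List ℕ) : R :=
  ((-1 : ℚ) ^ q.length * ((q.length.factorial : ℚ))⁻¹) • (q.map a).prod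

/-- The coefficient of `uʳ` in `exp (-∑ a_p uᵖ)`. -/
noncomputable def expCoeff (a : ℕ → R) (r : ℕ) : R := ∑ q ∈ posLists r, expTerm a q

lemma expCoeff_zero (a : ℕ → R) : expCoeff a 0 = 1 := by
  have : posLists 0 = {[]} := by
    ext p
    rw [mem_posLists, Finset.mem_singleton]
    constructor
    · rintro ⟨h, h'⟩
      have := length_le_sum_of_pos h
      exact List.length_eq_zero_iff.1 (by omega)
    · rintro rfl; simp
  simp [expCoeff, this, expTerm]

lemma finsupp_fin_two (e : Fin 2 →₀ ℕ) :
    e = Finsupp.single 0 (e 0) + Finsupp.single 1 (e 1) := by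
  ext i; fin_cases i <;> simp

lemma degree_fin_two (e : Fin 2 →₀ ℕ) : e.degree = e 0 + e 1 := by
  rw [Finsupp.degree_eq_sum, Fin.sum_univ_two]

/-- The coefficients of `exp (-A)` for a series `A = ∑_{p ≥ 1} a_p uᵖ` in the single variable
`u = X s`. -/
lemma coeff_expSubst_neg {σ : Type*} [DecidableEq σ] {a : ℕ → R} (ha : a 0 = 0) (s : σ)
    {A : MvPowerSeries σ R}
    (hA : ∀ e, coeff e A = if e = Finsupp.single s (e s) then a (e s) else 0) (e : σ →₀ ℕ) :
    coeff e (expSubst (-A)) = if e = Finsupp.single s (e s) then expCoeff a (e s) else 0 := by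
  set N := e.degree with hN
  have hA0 : constantCoeff (-A) = 0 := by
    rw [map_neg, ← coeff_zero_eq_constantCoeff_apply, hA]; simp [ha]
  have hEq : EqTo N A (∑ p ∈ Finset.Icc 1 N, monomial (Finsupp.single s p) (a p)) := by
    intro d hd
    rw [hA, map_sum]
    simp only [coeff_monomial]
    by_cases h : d = Finsupp.single s (d s)
    · rw [if_pos h]
      rw [h, Finsupp.degree_single] at hd
      rcases Nat.eq_zero_or_pos (d s) with h0 | h0
      · rw [h0, ha, Finset.sum_eq_zero]
        intro p hp
        rw [if_neg]
        intro h'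
        rw [h'] at h0
        simp only [Finsupp.single_eq_same] at h0
        have := (Finset.mem_Icc.1 hp).1
        omega
      · rw [Finset.sum_eq_single (d s), if_pos h]
        · intro p _ hp
          rw [if_neg]
          intro h'
          apply hp
          rw [h']; simp
        · intro h'
          exact absurd (Finset.mem_Icc.2 ⟨h0, hd⟩) h'
    · rw [if_neg h, Finset.sum_eq_zero]
      intro p _
      rw [if_neg]
      rintro rfl
      simp at h
  have hpow : ∀ n, coeff e ((-A) ^ n) = ∑ Q ∈ Fintype.piFinset fun _ : Fin n => Finset.Icc 1 N,
      if Finsupp.single s (∑ b, Q b) = e then (-1) ^ n * ∏ b, a (Q b) else 0 := by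
    intro n
    rw [neg_pow, ← map_one (C (σ := σ) (R := R)), ← map_neg, ← map_pow, coeff_C_mul,
      hEq.pow n e le_rfl, coeff_sum_monomial_pow, Finset.mul_sum]
    refine Finset.sum_congr rfl fun Q _ => ?_
    rw [Finsupp.single_finsetSum]
    split_ifs <;> simp
  rw [coeff_expSubst hA0 (Nat.lt_succ_self N)]
  simp only [hpow]
  have : ∀ l : List ℕ, ((l.length.factorial : ℚ)⁻¹) •
      (if Finsupp.single s l.sum = e then (-1) ^ l.length * (l.map a).prod else 0) =
      if Finsupp.single s l.sum = e then expTerm a l else 0 := by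
    intro l
    split_ifs
    · rw [expTerm, mul_comm ((-1 : ℚ) ^ l.length), mul_smul]
      congr 1
      rw [Algebra.smul_def]; simp
    · simp
  have h2 := sum_listsIn (Finset.Icc 1 N) (N + 1) (fun l : List ℕ =>
    ((l.length.factorial : ℚ)⁻¹) •
      (if Finsupp.single s l.sum = e then (-1) ^ l.length * (l.map a).prod else 0))
  simp only [List.length_ofFn, List.sum_ofFn, List.map_ofFn, List.prod_ofFn,
    Function.comp_apply] at h2
  simp only [Finset.smul_sum]
  rw [← h2]
  simp only [this]
  rw [← Finset.sum_filter]
  split_ifs with h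
  · refine Finset.sum_congr ?_ fun _ _ => rfl
    ext p
    have hNs : N = e s := by rw [hN, h]; simp
    simp only [Finset.mem_filter, mem_listsIn, mem_posLists, Finset.mem_Icc]
    constructor
    · rintro ⟨⟨-, h1⟩, h2⟩
      refine ⟨fun x hx => (h1 x hx).1, ?_⟩
      rw [← h2]; simp
    · rintro ⟨h1, h2⟩
      refine ⟨⟨?_, fun x hx => ⟨h1 x hx, ?_⟩⟩, by rw [h2, ← h]⟩
      · have := length_le_sum_of_pos h1
        omega
      · have := List.le_sum_of_mem hx
        omega
  · rw [Finset.filter_false_of_mem, Finset.sum_empty]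
    rintro l - rfl
    simp at h

/-- The polynomial `∑_{a + b = r, a, b > 0} u^a v^b`. -/
noncomputable def splitPoly (R : Type*) [CommRing R] (r : ℕ) : MvPowerSeries (Fin 2) R :=
  ∑ x ∈ (Finset.HasAntidiagonal.antidiagonal r).filter fun x => 0 < x.1 ∧ 0 < x.2,
    monomial (Finsupp.single 0 x.1 + Finsupp.single 1 x.2) 1

lemma coeff_splitPoly (r : ℕ) (e : Fin 2 →₀ ℕ) :
    coeff e (splitPoly R r) = if 0 < e 0 ∧ 0 < e 1 ∧ e 0 + e 1 = r then 1 else 0 := by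
  classical
  rw [splitPoly, map_sum]
  simp only [coeff_monomial]
  split_ifs with h
  · rw [Finset.sum_eq_single (e 0, e 1), if_pos (finsupp_fin_two e)]
    · rintro ⟨x, y⟩ _ hb
      rw [if_neg]
      intro h'
      apply hb
      rw [h']; simp
    · intro h'
      simp only [Finset.mem_filter, Finset.HasAntidiagonal.mem_antidiagonal] at h'
      omega
  · refine Finset.sum_eq_zero ?_
    rintro ⟨x, y⟩ hx
    rw [if_neg]
    rintro rfl
    apply h
    simp only [Finset.mem_filter, Finset.HasAntidiagonal.mem_antidiagonal] at hx
    simp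
    omega

/-- `P i j r` is the coefficient of `uⁱ vʲ` in the product of the polynomials `splitPoly r_a`. -/
lemma coeff_prod_splitPoly (r : List ℕ) (e : Fin 2 →₀ ℕ) :
    coeff e ((r.map (splitPoly R)).prod) = (P (e 0) (e 1) r : R) := by
  classical
  have h1 : (r.map (splitPoly R)).prod = ∏ a : Fin r.length, splitPoly R (r.get a) := by
    rw [← List.prod_ofFn]
    congr 1
    conv_lhs => rw [← List.ofFn_get r, List.map_ofFn]
    rfl
  rw [h1]
  unfold splitPoly
  rw [Finset.prod_univ_sum, map_sum]
  simp only [prod_monomial, Finset.prod_const_one, coeff_monomial]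
  rw [Finset.sum_boole, P]
  congr 1
  refine Finset.card_bij' (fun φ _ => (fun a => (φ a).1, fun a => (φ a).2))
    (fun ab _ a => (ab.1 a, ab.2 a)) ?_ ?_ (fun _ _ => rfl) (fun _ _ => rfl)
  · intro φ hφ
    simp only [Finset.mem_filter, Fintype.mem_piFinset,
      Finset.HasAntidiagonal.mem_antidiagonal] at hφ
    simp only [Finset.mem_filter, Finset.mem_product, Finset.Nat.mem_antidiagonalTuple]
    refine ⟨⟨?_, ?_⟩, fun a => ⟨(hφ.1 a).2.1, (hφ.1 a).2.2, (hφ.1 a).1⟩⟩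
    · rw [hφ.2]; simp [Finset.sum_add_distrib]
    · rw [hφ.2]; simp [Finset.sum_add_distrib]
  · rintro ⟨α, β⟩ h
    simp only [Finset.mem_filter, Finset.mem_product, Finset.Nat.mem_antidiagonalTuple] at h
    simp only [Finset.mem_filter, Fintype.mem_piFinset, Finset.HasAntidiagonal.mem_antidiagonal]
    refine ⟨fun a => ⟨(h.2 a).2.2, (h.2 a).1, (h.2 a).2.1⟩, ?_⟩
    rw [Finset.sum_add_distrib, ← Finsupp.single_finsetSum, ← Finsupp.single_finsetSum,
      h.1.1, h.1.2]
    exact finsupp_fin_two e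

lemma prod_map_smul_splitPoly (w : List ℕ → R) (l : List (List ℕ)) :
    (l.map fun q => C (w q) * splitPoly R q.sum).prod =
      C (l.map w).prod * ((l.map List.sum).map (splitPoly R)).prod := by
  induction l with
  | nil => simp
  | cons q l ih =>
    simp only [List.map_cons, List.prod_cons, ih, map_mul]
    ring

lemma prod_map_expTerm (a : ℕ → R) (l : List (List ℕ)) :
    (l.map (expTerm a)).prod = ((-1 : ℚ) ^ l.flatten.length *
      (((l.map List.length).map Nat.factorial).prod : ℚ)⁻¹) • (l.flatten.map a).prod := by
  induction l with
  | nil => simp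
  | cons q l ih =>
    simp only [List.map_cons, List.prod_cons, ih, expTerm, List.flatten_cons, List.length_append,
      List.map_append, List.prod_append, smul_mul_smul_comm]
    congr 1
    push_cast
    rw [mul_inv, pow_add]
    ring

/-- The powers of the series `∑_{i, j > 0} h_{i+j} uⁱ vʲ`, where `h` are the coefficients of
`exp (-∑ a_p uᵖ)`. -/
lemma coeff_pow_of_expCoeff {a : ℕ → R} {H : MvPowerSeries (Fin 2) R}
    (hH : ∀ e, coeff e H = if 0 < e 0 ∧ 0 < e 1 then expCoeff a (e 0 + e 1) else 0)
    (e : Fin 2 →₀ ℕ) (Λ : Finset (List ℕ))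
    (hΛ : ∀ q, q ∈ Λ ↔ q ≠ [] ∧ (∀ x ∈ q, 0 < x) ∧ q.sum ≤ e 0 + e 1) (k : ℕ) :
    coeff e (H ^ k) = ∑ Q ∈ Fintype.piFinset fun _ : Fin k => Λ,
      (((List.ofFn Q).map (expTerm a)).prod *
        (P (e 0) (e 1) ((List.ofFn Q).map List.sum) : R)) := by
  have hEq : EqTo (e 0 + e 1) H (∑ q ∈ Λ, C (expTerm a q) * splitPoly R q.sum) := by
    intro d hd
    rw [degree_fin_two] at hd
    rw [hH, map_sum]
    simp only [coeff_C_mul, coeff_splitPoly]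
    split_ifs with h
    · simp only [h.1, h.2, true_and, mul_ite, mul_one, mul_zero]
      rw [← Finset.sum_filter, expCoeff]
      refine Finset.sum_congr ?_ fun _ _ => rfl
      ext q
      simp only [mem_posLists, Finset.mem_filter, hΛ]
      constructor
      · rintro ⟨h1, h2⟩
        refine ⟨⟨?_, h1, by omega⟩, h2.symm⟩
        rintro rfl
        simp only [List.sum_nil] at h2
        omega
      · rintro ⟨⟨-, h1, -⟩, h2⟩
        exact ⟨h1, h2.symm⟩
    · refine (Finset.sum_eq_zero fun q _ => ?_).symm
      rw [if_neg (by tauto), mul_zero]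
  rw [hEq.pow k e (degree_fin_two e).le]
  have h1 : (∑ q ∈ Λ, C (expTerm a q) * splitPoly R q.sum) ^ k =
      ∏ _b : Fin k, ∑ q ∈ Λ, C (expTerm a q) * splitPoly R q.sum := by simp
  rw [h1, Finset.prod_univ_sum, map_sum]
  refine Finset.sum_congr rfl fun Q _ => ?_
  rw [← coeff_prod_splitPoly, ← coeff_C_mul, ← prod_map_smul_splitPoly, List.map_ofFn,
    List.prod_ofFn]
  rfl

lemma coeff_X_mul_fin_two (s : Fin 2) (f : MvPowerSeries (Fin 2) R) (e : Fin 2 →₀ ℕ) :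
    coeff e (X s * f) = if 0 < e s then coeff (e - Finsupp.single s 1) f else 0 := by
  classical
  rw [X, coeff_monomial_mul, one_mul]
  congr 1
  rw [Finsupp.single_le_iff]
  rfl

/-- The Hirota equation expresses `exp B` by the coefficients of the exponentials on its right-hand
side. -/
lemma expSubst_eq_of_hirota [IsDomain R] {a : ℕ → R} (ha : a 0 = 0)
    {A₀ A₁ B H : MvPowerSeries (Fin 2) R}
    (hA₀ : ∀ e, coeff e A₀ = if e = Finsupp.single 0 (e 0) then a (e 0) else 0)
    (hA₁ : ∀ e, coeff e A₁ = if e = Finsupp.single 1 (e 1) then a (e 1) else 0)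
    (hH : ∀ e, coeff e H = if 0 < e 0 ∧ 0 < e 1 then expCoeff a (e 0 + e 1) else 0)
    (h : (X 1 - X 0) * expSubst B = X 1 * expSubst (-A₀) - X 0 * expSubst (-A₁)) :
    expSubst B = 1 - H := by
  have hX : (X 1 - X 0 : MvPowerSeries (Fin 2) R) ≠ 0 := by
    intro h
    have := congrArg (coeff (Finsupp.single 1 1)) h
    simp [coeff_X, Finsupp.single_eq_single_iff] at this
  apply mul_left_cancel₀ hX
  rw [h]
  ext e
  have e0 : ∀ (s t : Fin 2) (e : Fin 2 →₀ ℕ), s ≠ t →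
      (e = Finsupp.single s (e s) ↔ e t = 0) := by
    intro s t e hst
    constructor
    · intro h; rw [h, Finsupp.single_eq_of_ne hst.symm]
    · intro h; ext i
      by_cases hi : i = s
      · subst hi; simp
      · have : i = t := by omega
        subst this
        rw [h, Finsupp.single_eq_of_ne hst.symm]
  have e1 : ∀ e : Fin 2 →₀ ℕ, e = 0 ↔ e 0 = 0 ∧ e 1 = 0 := by
    intro e
    rw [Finsupp.ext_iff, Fin.forall_fin_two]; rfl
  rw [sub_mul, map_sub, map_sub]
  simp only [coeff_X_mul_fin_two, coeff_expSubst_neg ha 0 hA₀, coeff_expSubst_neg ha 1 hA₁,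
    map_sub, hH, coeff_one, e0 0 1 _ (by decide), e0 1 0 _ (by decide), e1]
  simp only [Finsupp.coe_tsub, Pi.sub_apply, Finsupp.single_eq_same,
    Finsupp.single_eq_of_ne (show (0 : Fin 2) ≠ 1 by decide),
    Finsupp.single_eq_of_ne (show (1 : Fin 2) ≠ 0 by decide), Nat.sub_zero]
  generalize e 0 = i
  generalize e 1 = j
  rcases i with _ | _ | i <;> rcases j with _ | _ | j <;>
    simp [expCoeff_zero, add_assoc, add_comm, add_left_comm]

/-- The Hirota equation `(v - u) exp (∑ b_{ij} uⁱ vʲ) = v exp (-∑ a_p uᵖ) - u exp (-∑ a_p vᵖ)`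
determines the `b_{ij}`: they are polynomials in the `a_p` whose coefficients are the constants
`T₂ i j p`. -/
theorem coeff_eq_of_hirota [IsDomain R] {a : ℕ → R} (ha : a 0 = 0)
    {A₀ A₁ B : MvPowerSeries (Fin 2) R}
    (hA₀ : ∀ e, coeff e A₀ = if e = Finsupp.single 0 (e 0) then a (e 0) else 0)
    (hA₁ : ∀ e, coeff e A₁ = if e = Finsupp.single 1 (e 1) then a (e 1) else 0)
    (hB : constantCoeff B = 0)
    (h : (X 1 - X 0) * expSubst B = X 1 * expSubst (-A₀) - X 0 * expSubst (-A₁))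
    (e : Fin 2 →₀ ℕ) :
    coeff e B = ∑ p ∈ posLists (e 0 + e 1), T₂ (e 0) (e 1) p • (p.map a).prod := by
  classical
  set H : MvPowerSeries (Fin 2) R := fun e =>
    if 0 < e 0 ∧ 0 < e 1 then expCoeff a (e 0 + e 1) else 0 with hHdef
  have hH : ∀ e, coeff e H = if 0 < e 0 ∧ 0 < e 1 then expCoeff a (e 0 + e 1) else 0 :=
    fun e => rfl
  have hH0 : constantCoeff H = 0 := by
    rw [← coeff_zero_eq_constantCoeff_apply, hH]; simp
  have hexp := expSubst_eq_of_hirota ha hA₀ hA₁ hH h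
  set n := e 0 + e 1 with hn
  set Λ : Finset (List ℕ) := ((Finset.range (n + 1)).biUnion posLists).erase [] with hΛdef
  have hΛ : ∀ q, q ∈ Λ ↔ q ≠ [] ∧ (∀ x ∈ q, 0 < x) ∧ q.sum ≤ n := by
    intro q
    simp only [hΛdef, Finset.mem_erase, Finset.mem_biUnion, Finset.mem_range, mem_posLists,
      Nat.lt_succ_iff]
    refine and_congr_right fun _ => ⟨?_, fun h => ⟨q.sum, h.2, h.1, rfl⟩⟩
    rintro ⟨m, hm, hq, rfl⟩
    exact ⟨hq, hm⟩
  rw [coeff_eq_of_expSubst_eq_one_sub hB hH0 hexp (N := n) (degree_fin_two e).le]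
  -- the term `k = 0` may be added because `0⁻¹ = 0`
  have h1 : ∑ k ∈ Finset.range n, ((k : ℚ) + 1)⁻¹ • coeff e (H ^ (k + 1)) =
      ∑ k ∈ Finset.range (n + 1), (k : ℚ)⁻¹ • coeff e (H ^ k) := by
    rw [Finset.sum_range_succ']
    simp
  set g : List (List ℕ) → R := fun l => (l.length : ℚ)⁻¹ •
      ((l.map (expTerm a)).prod * (P (e 0) (e 1) (l.map List.sum) : R)) with hg
  have h2 := sum_listsIn Λ (n + 1) g
  simp only [hg, List.length_ofFn] at h2
  rw [h1]
  simp only [coeff_pow_of_expCoeff hH e Λ hΛ, Finset.smul_sum]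
  rw [← h2, ← hg]
  have h3 : ∑ l ∈ listsIn Λ (n + 1), g l =
      ∑ l ∈ (listsIn Λ (n + 1)).filter (fun l => l.flatten.sum = n), g l := by
    rw [Finset.sum_filter_of_ne]
    intro l _ hl
    by_contra hne
    apply hl
    simp only [hg]
    rw [P_eq_zero, Nat.cast_zero, mul_zero, smul_zero]
    rwa [sum_map_sum_flatten]
  change -∑ l ∈ listsIn Λ (n + 1), g l = _
  rw [h3, ← sum_posLists_composition n Λ hΛ g, ← Finset.sum_neg_distrib]
  refine Finset.sum_congr rfl fun p _ => ?_
  rw [T₂, Finset.sum_smul, ← Finset.sum_neg_distrib]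
  refine Finset.sum_congr rfl fun c _ => ?_
  simp only [hg]
  rw [prod_map_expTerm, List.flatten_splitWrtComposition, List.map_length_splitWrtComposition,
    List.length_splitWrtComposition, smul_mul_assoc, mul_comm _ (Nat.cast _), ← nsmul_eq_mul,
    ← Nat.cast_smul_eq_nsmul ℚ, smul_smul, smul_smul, ← neg_smul]
  congr 1
  push_cast
  rw [pow_succ, div_eq_mul_inv, mul_inv]
  ring

end Hirota

/-! ### Iterated derivations of products -/

section Leibniz

variable {S : Type*} [CommRing S] [Algebra ℚ S] (d : Derivation ℚ S S)

lemma iterate_derivation_mul (n : ℕ) (x y : S) :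
    d^[n] (x * y) = ∑ ij ∈ Finset.HasAntidiagonal.antidiagonal n,
      n.choose ij.1 • (d^[ij.1] x * d^[ij.2] y) := by
  induction n with
  | zero => simp
  | succ n ih =>
    rw [Finset.sum_antidiagonal_choose_succ_nsmul (M := S) (fun i j => d^[i] x * d^[j] y) n]
    simp only [Function.iterate_succ_apply', ih, map_sum, map_nsmul, Derivation.leibniz,
      smul_add, Finset.sum_add_distrib, smul_eq_mul]
    congr 1
    refine Finset.sum_congr rfl fun ij hij => ?_
    rw [n.choose_symm_of_eq_add (Finset.HasAntidiagonal.mem_antidiagonal.1 hij).symm, mul_comm]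

/-- The divided power `dⁿ / n!` of a derivation. -/
noncomputable def divIter (n : ℕ) (x : S) : S := ((n.factorial : ℚ)⁻¹) • d^[n] x

lemma divIter_mul (n : ℕ) (x y : S) :
    divIter d n (x * y) = ∑ ij ∈ Finset.HasAntidiagonal.antidiagonal n,
      divIter d ij.1 x * divIter d ij.2 y := by
  rw [divIter, iterate_derivation_mul, Finset.smul_sum]
  refine Finset.sum_congr rfl fun ij hij => ?_
  have h := Finset.HasAntidiagonal.mem_antidiagonal.1 hij
  rw [divIter, divIter, smul_mul_smul_comm, ← Nat.cast_smul_eq_nsmul ℚ, smul_smul]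
  congr 1
  have h2 : ((ij.1 + ij.2).choose ij.1 : ℚ) * ij.1.factorial * ij.2.factorial =
      (ij.1 + ij.2).factorial := by
    rw [Nat.choose_symm_add]
    exact_mod_cast Nat.add_choose_mul_factorial_mul_factorial ij.1 ij.2
  rw [← h]
  field_simp
  linear_combination h2

/-- The Taylor homomorphism `x ↦ ∑ dⁿ(x) / n! Xⁿ`. -/
noncomputable def taylorHom : S →* PowerSeries S where
  toFun x := PowerSeries.mk fun n => divIter d n x
  map_one' := by
    ext n
    rw [PowerSeries.coeff_mk, PowerSeries.coeff_one]
    rcases n with _ | n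
    · simp [divIter]
    · rw [divIter, Function.iterate_succ_apply, Derivation.map_one_eq_zero, if_neg (by simp),
        iterate_map_zero, smul_zero]
  map_mul' x y := by
    ext n
    rw [PowerSeries.coeff_mul, PowerSeries.coeff_mk, divIter_mul]
    simp

lemma divIter_prod (l n K : ℕ) (hK : l < K) (y : Fin n → S) :
    divIter d l (∏ a, y a) =
      ∑ e ∈ (Fintype.piFinset fun _ : Fin n => Finset.range K).filter fun e => ∑ a, e a = l,
        ∏ a, divIter d (e a) (y a) := by
  have h : ∀ x, divIter d l x = PowerSeries.coeff l (taylorHom d x) := fun x => by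
    simp [taylorHom]
  rw [h, map_prod, PowerSeries.coeff_prod]
  refine Finset.sum_bij (fun e _ => ⇑e) ?_ (fun _ _ _ _ h => DFunLike.coe_injective h) ?_ ?_
  · intro e he
    simp only [Finset.mem_finsuppAntidiag] at he
    simp only [Finset.mem_filter, Fintype.mem_piFinset, Finset.mem_range]
    refine ⟨fun a => ?_, he.1⟩
    have := Finset.single_le_sum (f := e) (fun _ _ => Nat.zero_le _) (Finset.mem_univ a)
    have h2 : ∑ b, e b = l := he.1
    omega
  · intro e he
    simp only [Finset.mem_filter] at he
    refine ⟨Finsupp.equivFunOnFinite.symm e, ?_, rfl⟩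
    simp only [Finset.mem_finsuppAntidiag]
    exact ⟨he.2, Finset.subset_univ _⟩
  · intro e _
    simp [taylorHom]

/-- Leibniz' rule for `dˡ / l!`, summed over lists `p` of indices with entries in `Λ`. A column
`(x, e + 1)` of `M` records that the factor `y x` is differentiated `e` times. -/
lemma sum_divIter_prod {ι : Type*} (Λ : Finset ι) (N l K : ℕ) (hK : l + 1 < K) (c : List ι → ℚ)
    (y : ι → S) :
    ∑ p ∈ listsIn Λ N, c p • divIter d l (p.map y).prod =
      ∑ M ∈ listsIn (Λ ×ˢ Finset.range K) N,
        if (∀ q ∈ M, 1 ≤ q.2) ∧ (M.map fun q => q.2 - 1).sum = l then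
          c (M.map Prod.fst) • (M.map fun q => divIter d (q.2 - 1) (y q.1)).prod else 0 := by
  classical
  rw [sum_listsIn, sum_listsIn]
  refine Finset.sum_congr rfl fun n _ => ?_
  have h1 : ∀ Q : Fin n → ι, c (List.ofFn Q) • divIter d l ((List.ofFn Q).map y).prod =
      ∑ e ∈ (Fintype.piFinset fun _ : Fin n => Finset.range (K - 1)).filter
        fun e => ∑ a, e a = l, c (List.ofFn Q) • ∏ a, divIter d (e a) (y (Q a)) := by
    intro Q
    rw [List.map_ofFn, List.prod_ofFn, ← Finset.smul_sum, ← divIter_prod d l n (K - 1) (by omega)]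
    rfl
  rw [Finset.sum_congr rfl fun Q _ => h1 Q, Finset.sum_sigma', ← Finset.sum_filter]
  refine Finset.sum_bij' (fun x _ a => (x.1 a, x.2 a + 1))
    (fun Q _ => ⟨fun a => (Q a).1, fun a => (Q a).2 - 1⟩) ?_ ?_ ?_ ?_ ?_
  · rintro ⟨Q, e⟩ h
    simp only [Finset.mem_sigma, Finset.mem_filter, Fintype.mem_piFinset, Finset.mem_range] at h
    simp only [Finset.mem_filter, Fintype.mem_piFinset, Finset.mem_product, Finset.mem_range,
      List.forall_mem_ofFn_iff, List.map_ofFn, List.sum_ofFn, Function.comp_apply,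
      Nat.add_sub_cancel]
    refine ⟨fun a => ⟨h.1 a, ?_⟩, fun a => by omega, h.2.2⟩
    have := h.2.1 a
    omega
  · intro Q h
    simp only [Finset.mem_filter, Fintype.mem_piFinset, Finset.mem_product, Finset.mem_range,
      List.forall_mem_ofFn_iff, List.map_ofFn, List.sum_ofFn, Function.comp_apply] at h
    simp only [Finset.mem_sigma, Finset.mem_filter, Fintype.mem_piFinset, Finset.mem_range]
    refine ⟨fun a => (h.1 a).1, fun a => ?_, h.2.2⟩
    have h1 := (h.1 a).2
    have h2 := h.2.1 a
    omega
  · rintro ⟨Q, e⟩ _; rfl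
  · intro Q h
    simp only [Finset.mem_filter, List.forall_mem_ofFn_iff] at h
    funext a
    have := h.2.1 a
    ext
    · rfl
    · simp only; omega
  · rintro ⟨Q, e⟩ _
    simp only [List.map_ofFn, List.prod_ofFn, Function.comp_apply, Nat.add_sub_cancel]
    congr 1

/-- A derivation of the product of a list. -/
lemma derivation_list_prod {ι : Type*} (D : Derivation ℚ S S) (y : ι → S) (i₀ : ι) (L : List ι) :
    D (L.map y).prod = ∑ a ∈ Finset.range L.length,
      ((L.take a).map y).prod * D (y (L.getD a i₀)) * ((L.drop (a + 1)).map y).prod := by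
  induction L with
  | nil => simp
  | cons x L ih =>
    rw [List.length_cons, Finset.sum_range_succ']
    simp only [List.map_cons, List.prod_cons, Derivation.leibniz, smul_eq_mul, List.take_succ_cons,
      List.drop_succ_cons, List.getD_cons_succ, List.take_zero, List.map_nil, List.prod_nil,
      one_mul, List.getD_cons_zero, List.drop_zero, ih, Finset.mul_sum]
    rw [mul_comm (List.map y L).prod]
    congr 1
    exact Finset.sum_congr rfl fun a _ => by ring

end Leibniz

/-! ### The constants `T` as coefficients of higher derivatives -/

section Columns

/-- The lists of columns `(s, l)` with `0 < s`, `l < K` and `∑ s = n`. -/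
def colLists (n K : ℕ) : Finset (List (ℕ × ℕ)) :=
  (listsIn (Finset.Icc 1 n ×ˢ Finset.range K) (n + 1)).filter fun L => (L.map Prod.fst).sum = n

lemma mem_colLists {n K : ℕ} {L : List (ℕ × ℕ)} :
    L ∈ colLists n K ↔ (∀ q ∈ L, 0 < q.1 ∧ q.2 < K) ∧ (L.map Prod.fst).sum = n := by
  simp only [colLists, Finset.mem_filter, mem_listsIn, Finset.mem_product, Finset.mem_Icc,
    Finset.mem_range]
  constructor
  · rintro ⟨⟨-, h⟩, h'⟩
    exact ⟨fun q hq => ⟨(h q hq).1.1, (h q hq).2⟩, h'⟩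
  · rintro ⟨h, h'⟩
    refine ⟨⟨?_, fun q hq => ⟨⟨(h q hq).1, ?_⟩, (h q hq).2⟩⟩, h'⟩
    · have := length_le_sum_of_pos (p := L.map Prod.fst) fun x hx => by
        obtain ⟨q, hq, rfl⟩ := List.mem_map.1 hx
        exact (h q hq).1
      rw [List.length_map] at this
      omega
    · rw [← h']
      exact List.le_sum_of_mem (List.mem_map_of_mem hq)

/-- One summand in the recursion for `TRev`: the block `B` of `cols` between the positions `a` and
`b` is replaced by one column. -/
def stepTerm (t : List (ℕ × ℕ) → ℚ) (ik : ℕ) (cols : List (ℕ × ℕ)) (a b : ℕ) : ℚ :=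
  let B := (cols.take b).drop a
  let s := (B.map Prod.fst).sum - ik
  let l := (B.map fun q => q.2 - 1).sum
  if ik < (B.map Prod.fst).sum ∧ 0 < l ∧ ∀ q ∈ B, 1 ≤ q.2 then
    (l.factorial : ℚ) / ((B.map fun q => (q.2 - 1).factorial).prod : ℕ) *
      t (cols.take a ++ (s, l) :: cols.drop b) * T₂ s ik (B.map Prod.fst)
  else 0

lemma TRev_step {R : List ℕ} (hR : 2 ≤ R.length) (ik : ℕ) (cols : List (ℕ × ℕ)) :
    TRev (ik :: R) cols = ∑ b ∈ Finset.range (cols.length + 1), ∑ a ∈ Finset.range b,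
      stepTerm (TRev R) ik cols a b := by
  match R, hR with
  | i :: i' :: is, _ => rw [TRev]; rfl

lemma exists_of_TRev_step_ne_zero {R : List ℕ} (hR : 2 ≤ R.length) {ik : ℕ} {cols : List (ℕ × ℕ)}
    (h : TRev (ik :: R) cols ≠ 0) :
    ∃ L₁ B L₂ s, cols = L₁ ++ (B ++ L₂) ∧ (B.map Prod.fst).sum = s + ik ∧ (∀ q ∈ B, 1 ≤ q.2) ∧
      TRev R (L₁ ++ (s, (B.map fun q => q.2 - 1).sum) :: L₂) ≠ 0 := by
  rw [TRev_step hR] at h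
  obtain ⟨b, -, h⟩ := Finset.exists_ne_zero_of_sum_ne_zero h
  obtain ⟨a, ha, h⟩ := Finset.exists_ne_zero_of_sum_ne_zero h
  rw [Finset.mem_range] at ha
  unfold stepTerm at h
  extract_lets B s l at h
  split_ifs at h with hc
  · refine ⟨cols.take a, (cols.take b).drop a, cols.drop b, _, ?_,
      (Nat.sub_add_cancel hc.1.le).symm, hc.2.2, right_ne_zero_of_mul (left_ne_zero_of_mul h)⟩
    rw [← List.append_assoc]
    conv_lhs => rw [← List.take_append_drop b cols]
    congr 1
    conv_lhs => rw [← List.take_append_drop a (cols.take b)]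
    rw [List.take_take, min_eq_left ha.le]
  · exact absurd rfl h

lemma two_le_length_induction {motive : ∀ R : List ℕ, R ≠ [] → Prop}
    (h1 : ∀ i, motive [i] (List.cons_ne_nil _ _)) (h2 : ∀ j i, motive [j, i] (List.cons_ne_nil _ _))
    (h3 : ∀ ik R, 2 ≤ R.length → ∀ h0 : R ≠ [], motive R h0 →
      motive (ik :: R) (List.cons_ne_nil _ _)) (R : List ℕ) (hR : R ≠ []) :
    motive R hR := by
  induction R with
  | nil => exact absurd rfl hR
  | cons ik R ih =>
    match R, ih with
    | [], _ => exact h1 ik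
    | [i], _ => exact h2 ik i
    | i :: i' :: is, ih => exact h3 _ _ (by simp) _ (ih (by simp))

lemma sum_fst_of_TRev_ne_zero {R : List ℕ} {cols : List (ℕ × ℕ)} (h : TRev R cols ≠ 0) :
    (cols.map Prod.fst).sum = R.sum := by
  have hR : R ≠ [] := by rintro rfl; exact h rfl
  induction R, hR using two_le_length_induction generalizing cols with
  | h1 i =>
    rw [TRev] at h
    split_ifs at h with hc
    · simp [hc]
    · exact absurd rfl h
  | h2 j i =>
    rw [TRev] at h
    split_ifs at h with hc
    · by_contra hne
      exact h (T₂_eq_zero fun h' => hne (by simp [h', add_comm]))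
    · exact absurd rfl h
  | h3 ik R hR _ ih =>
    obtain ⟨L₁, B, L₂, s, rfl, hs, -, ht⟩ := exists_of_TRev_step_ne_zero hR h
    have := ih ht
    simp only [List.map_append, List.map_cons, List.sum_append, List.sum_cons] at this ⊢
    omega

lemma sum_sub_one_add_length {B : List (ℕ × ℕ)} (h : ∀ q ∈ B, 1 ≤ q.2) :
    (B.map fun q => q.2 - 1).sum + B.length = (B.map Prod.snd).sum := by
  induction B with
  | nil => rfl
  | cons q B ih =>
    have h1 := h q (by simp)
    have h2 := ih fun x hx => h x (by simp [hx])
    simp only [List.map_cons, List.sum_cons, List.length_cons]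
    omega

/-- Each step of the recursion raises `∑ l - #columns` by one, starting from `-1`. -/
lemma sum_snd_of_TRev_ne_zero {R : List ℕ} {cols : List (ℕ × ℕ)} (h : TRev R cols ≠ 0) :
    (cols.map Prod.snd).sum + 2 = R.length + cols.length := by
  have hR : R ≠ [] := by rintro rfl; exact h rfl
  induction R, hR using two_le_length_induction generalizing cols with
  | h1 i =>
    rw [TRev] at h
    split_ifs at h with hc
    · simp [hc]
    · exact absurd rfl h
  | h2 j i =>
    rw [TRev] at h
    split_ifs at h with hc
    · have h1 : cols.map Prod.snd = cols.map fun _ => 1 := List.map_congr_left hc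
      rw [h1]; simp [add_comm]
    · exact absurd rfl h
  | h3 ik R hR _ ih =>
    obtain ⟨L₁, B, L₂, s, rfl, -, hB, ht⟩ := exists_of_TRev_step_ne_zero hR h
    have := ih ht
    have := sum_sub_one_add_length hB
    simp only [List.map_append, List.map_cons, List.sum_append, List.sum_cons, List.length_append,
      List.length_cons] at *
    omega

lemma one_le_snd_of_TRev_ne_zero {R : List ℕ} (hR2 : 2 ≤ R.length) {cols : List (ℕ × ℕ)}
    (h : TRev R cols ≠ 0) : ∀ q ∈ cols, 1 ≤ q.2 := by
  have hR : R ≠ [] := by rintro rfl; exact h rfl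
  induction R, hR using two_le_length_induction generalizing cols with
  | h1 i => simp at hR2
  | h2 j i =>
    rw [TRev] at h
    split_ifs at h with hc
    · exact fun q hq => (hc q hq).ge
    · exact absurd rfl h
  | h3 ik R hR _ ih =>
    obtain ⟨L₁, B, L₂, s, rfl, -, hB, ht⟩ := exists_of_TRev_step_ne_zero hR h
    have := ih hR ht
    intro q hq
    simp only [List.mem_append, List.mem_cons] at hq this
    rcases hq with hq | hq | hq
    · exact this q (Or.inl hq)
    · exact hB q hq
    · exact this q (Or.inr (Or.inr hq))

lemma snd_lt_of_TRev_ne_zero {R : List ℕ} {cols : List (ℕ × ℕ)}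
    (h : TRev R cols ≠ 0) : ∀ q ∈ cols, q.2 < R.length := by
  have hs := sum_snd_of_TRev_ne_zero h
  rcases Nat.lt_or_ge R.length 2 with h2 | h2
  · match R, h2 with
    | [], _ => exact absurd rfl h
    | [i], _ =>
      rw [TRev] at h
      split_ifs at h with hc
      · simp [hc]
      · exact absurd rfl h
  · intro q hq
    have h1 := one_le_snd_of_TRev_ne_zero h2 h
    have h3 := sum_sub_one_add_length h1
    have h4 : q.2 - 1 ≤ (cols.map fun q => q.2 - 1).sum :=
      List.le_sum_of_mem (List.mem_map_of_mem (f := fun q : ℕ × ℕ => q.2 - 1) hq)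
    omega

end Columns

/-! ### Higher derivatives in the unbarred times -/

section Expansion

variable {S : Type*} [CommRing S] [Algebra ℚ S]

/-- The derivative `∂₀ˡ E_s F` attached to a column `(s, l)`. -/
def colVal (d : Derivation ℚ S S) (E : ℕ → Derivation ℚ S S) (F : S) (q : ℕ × ℕ) : S :=
  d^[q.2] (E q.1 F)

/-- The coefficient of the monomial of the columns `M` in `E_{ik}` of the monomial of the column
`c`. -/
def colCoeff (ik : ℕ) (c : ℕ × ℕ) (M : List (ℕ × ℕ)) : ℚ :=
  if (∀ q ∈ M, 1 ≤ q.2) ∧ (M.map fun q => q.2 - 1).sum = c.2 then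
    (c.2.factorial : ℚ) / ((M.map fun q => (q.2 - 1).factorial).prod : ℕ) *
      T₂ c.1 ik (M.map Prod.fst) else 0

lemma of_colCoeff_ne_zero {ik : ℕ} {c : ℕ × ℕ} {M : List (ℕ × ℕ)} (h : colCoeff ik c M ≠ 0) :
    (∀ q ∈ M, 1 ≤ q.2) ∧ (M.map fun q => q.2 - 1).sum = c.2 ∧
      (M.map Prod.fst).sum = c.1 + ik ∧ M ≠ [] := by
  rw [colCoeff] at h
  split_ifs at h with hc
  · refine ⟨hc.1, hc.2, ?_, ?_⟩
    · by_contra hne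
      exact right_ne_zero_of_mul h (T₂_eq_zero hne)
    · rintro rfl
      exact right_ne_zero_of_mul h (T₂_nil _ _)
  · exact absurd rfl h

variable {d : Derivation ℚ S S} {E : ℕ → Derivation ℚ S S} {F : S}

lemma prod_divIter_eq (M : List (ℕ × ℕ)) (hM : ∀ q ∈ M, 1 ≤ q.2) :
    (M.map fun q => divIter d (q.2 - 1) (d (E q.1 F))).prod =
      (((M.map fun q => (q.2 - 1).factorial).prod : ℕ) : ℚ)⁻¹ • (M.map (colVal d E F)).prod := by
  induction M with
  | nil => simp
  | cons q M ih =>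
    have hq := hM q (by simp)
    simp only [List.map_cons, List.prod_cons, ih fun x hx => hM x (by simp [hx])]
    have : divIter d (q.2 - 1) (d (E q.1 F)) =
        (((q.2 - 1).factorial : ℚ))⁻¹ • colVal d E F q := by
      rw [divIter, colVal, ← Function.iterate_succ_apply, Nat.succ_eq_add_one,
        Nat.sub_add_cancel hq]
    rw [this, smul_mul_smul_comm, Nat.cast_mul, mul_inv]

/-- `E_{ik}` of `∂₀ˡ E_s F`, expressed by columns: Leibniz' rule applied to the formula for
`E_{ik} E_s F`. -/
lemma apply_colVal (hcomm : ∀ i x, E i (d x) = d (E i x))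
    (hE : ∀ i j, 0 < i → 0 < j → E j (E i F) =
      ∑ p ∈ posLists (i + j), T₂ i j p • (p.map fun s => d (E s F)).prod)
    {ik : ℕ} (hik : 0 < ik) {c : ℕ × ℕ} (hc : 0 < c.1) {K : ℕ} (hK : c.2 + 1 < K) :
    E ik (colVal d E F c) =
      ∑ M ∈ colLists (c.1 + ik) K, colCoeff ik c M • (M.map (colVal d E F)).prod := by
  obtain ⟨s, l⟩ := c
  simp only at hc hK ⊢
  set n := s + ik with hn
  have hcomm' : ∀ l x, E ik (d^[l] x) = d^[l] (E ik x) := by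
    intro l
    induction l with
    | zero => simp
    | succ l ih => intro x; rw [Function.iterate_succ_apply, Function.iterate_succ_apply, ih, hcomm]
  have hlin : ∀ x, d^[l] x = (l.factorial : ℚ) • divIter d l x := by
    intro x
    rw [divIter, smul_smul, mul_inv_cancel₀ (by positivity), one_smul]
  have hpos : posLists n = (listsIn (Finset.Icc 1 n) (n + 1)).filter fun p => p.sum = n := by
    ext p
    simp only [mem_posLists, Finset.mem_filter, mem_listsIn, Finset.mem_Icc]
    constructor
    · rintro ⟨h, h'⟩
      refine ⟨⟨?_, fun x hx => ⟨h x hx, ?_⟩⟩, h'⟩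
      · have := length_le_sum_of_pos h
        omega
      · rw [← h']; exact List.le_sum_of_mem hx
    · rintro ⟨⟨-, h⟩, h'⟩
      exact ⟨fun x hx => (h x hx).1, h'⟩
  have hsum : E ik (E s F) = ∑ p ∈ listsIn (Finset.Icc 1 n) (n + 1),
      T₂ s ik p • (p.map fun s => d (E s F)).prod := by
    rw [hE s ik hc hik, hpos, Finset.sum_filter_of_ne]
    intro p _ h
    by_contra hne
    exact h (by rw [T₂_eq_zero hne, zero_smul])
  have hiter : ∀ (X : Finset (List ℕ)) (f : List ℕ → S),
      d^[l] (∑ p ∈ X, T₂ s ik p • f p) = ∑ p ∈ X, T₂ s ik p • d^[l] (f p) := by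
    intro X f
    have : ∀ x, d^[l] x = ((d : S →ₗ[ℚ] S) ^ l) x := by
      intro x; rw [Module.End.pow_apply]; rfl
    simp only [this, map_sum, map_smul]
  rw [colVal, hcomm', hsum, hiter]
  simp only [hlin, smul_comm (T₂ _ _ _) (l.factorial : ℚ)]
  rw [← Finset.smul_sum, sum_divIter_prod d (Finset.Icc 1 n) (n + 1) l K hK, colLists,
    Finset.sum_filter_of_ne, Finset.smul_sum]
  · refine Finset.sum_congr rfl fun M _ => ?_
    rw [colCoeff]
    split_ifs with h
    · rw [prod_divIter_eq M h.1, smul_smul, smul_smul]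
      congr 1
      rw [div_eq_mul_inv]; ring
    · rw [smul_zero, zero_smul]
  · intro M _ h
    have := (of_colCoeff_ne_zero (left_ne_zero_of_smul h)).2.2.1
    exact this

/-- The recursion for `TRev` is the effect of the derivation `E_{ik}` on a combination of monomials
in the columns. -/
lemma sum_TRev_step {R : List ℕ} (hR : 2 ≤ R.length) {ik : ℕ}
    (h : ∀ c : ℕ × ℕ, 0 < c.1 → ∀ K, c.2 + 1 < K → E ik (colVal d E F c) =
      ∑ M ∈ colLists (c.1 + ik) K, colCoeff ik c M • (M.map (colVal d E F)).prod) :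
    ∑ L ∈ colLists R.sum R.length, TRev R L • E ik (L.map (colVal d E F)).prod =
      ∑ L ∈ colLists (ik :: R).sum (ik :: R).length,
        TRev (ik :: R) L • (L.map (colVal d E F)).prod := by
  classical
  set K := R.length with hK
  set v := colVal d E F with hv
  -- both sides are sums over a column in a list together with a list replacing that column
  have hL : ∀ L ∈ colLists R.sum K, TRev R L • E ik (L.map v).prod =
      ∑ a ∈ Finset.range L.length,
        ∑ M ∈ colLists ((L.getD a (0, 0)).1 + ik) (K + 1),
          (TRev R L * colCoeff ik (L.getD a (0, 0)) M) •
            ((L.take a ++ (M ++ L.drop (a + 1))).map v).prod := by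
    intro L hL
    rw [derivation_list_prod _ _ (0, 0), Finset.smul_sum]
    refine Finset.sum_congr rfl fun a ha => ?_
    rw [Finset.mem_range] at ha
    rw [List.getD_eq_getElem _ _ ha]
    have hq := (mem_colLists.1 hL).1 _ (List.getElem_mem ha)
    rw [h _ hq.1 (K + 1) (by omega), Finset.mul_sum, Finset.sum_mul, Finset.smul_sum]
    refine Finset.sum_congr rfl fun M _ => ?_
    rw [mul_smul, List.map_append, List.map_append, List.prod_append, List.prod_append,
      mul_smul_comm, smul_mul_assoc, mul_assoc]
  rw [Finset.sum_congr rfl hL]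
  have hR' : ∀ L, TRev (ik :: R) L • (L.map v).prod =
      ∑ b ∈ Finset.range (L.length + 1), ∑ a ∈ Finset.range b,
        stepTerm (TRev R) ik L a b • (L.map v).prod := by
    intro L
    rw [TRev_step hR, Finset.sum_smul]
    exact Finset.sum_congr rfl fun b _ => Finset.sum_smul
  rw [Finset.sum_congr rfl fun L _ => hR' L, Finset.sum_sigma', Finset.sum_sigma',
    Finset.sum_sigma', Finset.sum_sigma']
  have key : ∀ (L₁ M L₂ : List (ℕ × ℕ)) (c : ℕ × ℕ), colCoeff ik c M ≠ 0 → 0 < c.1 →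
      TRev R (L₁ ++ c :: L₂) ≠ 0 →
      stepTerm (TRev R) ik (L₁ ++ (M ++ L₂)) L₁.length (L₁.length + M.length) =
        TRev R (L₁ ++ c :: L₂) * colCoeff ik c M := by
    intro L₁ M L₂ c hc hc1 ht
    obtain ⟨h1, h2, h3, -⟩ := of_colCoeff_ne_zero hc
    have hB : ((L₁ ++ (M ++ L₂)).take (L₁.length + M.length)).drop L₁.length = M := by
      rw [List.take_length_add_append, List.drop_left, List.take_left]
    have hd : (L₁ ++ (M ++ L₂)).drop (L₁.length + M.length) = L₂ := by
      rw [List.drop_length_add_append, List.drop_left]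
    have hcs : (((M.map Prod.fst).sum - ik, (M.map fun q => q.2 - 1).sum) : ℕ × ℕ) = c := by
      ext
      · simp only; omega
      · exact h2
    have hl := one_le_snd_of_TRev_ne_zero hR ht c (by simp)
    unfold stepTerm
    simp only [hB, hd, List.take_left, hcs]
    rw [if_pos ⟨by omega, by omega, h1⟩, colCoeff, if_pos ⟨h1, h2⟩, h2, h3, Nat.add_sub_cancel]
    ring
  -- the column number `a` of `L` is replaced by `M`, which then is the block from `a` to `a + #M`
  refine Finset.sum_bij_ne_zero
    (fun x _ _ => ⟨⟨x.1.1.take x.1.2 ++ (x.2 ++ x.1.1.drop (x.1.2 + 1)), x.1.2 + x.2.length⟩,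
      x.1.2⟩) ?_ ?_ ?_ ?_
  · rintro ⟨⟨L, a⟩, M⟩ hx hne
    simp only [Finset.mem_sigma, Finset.mem_range] at hx ⊢
    obtain ⟨⟨hL, ha⟩, hM⟩ := hx
    obtain ⟨L₁, c, L₂, rfl, rfl⟩ : ∃ L₁ c L₂, L = L₁ ++ c :: L₂ ∧ a = L₁.length :=
      ⟨L.take a, L[a], L.drop (a + 1), by simp, by simp [ha.le]⟩
    simp only [List.getD_append_right _ _ _ _ le_rfl, Nat.sub_self, List.getD_cons_zero] at hM hne
    have hne' := left_ne_zero_of_smul hne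
    have hc := of_colCoeff_ne_zero (right_ne_zero_of_mul hne')
    rw [mem_colLists] at hL hM
    have htake : (L₁ ++ c :: L₂).take L₁.length = L₁ := List.take_left
    have hdrop : (L₁ ++ c :: L₂).drop (L₁.length + 1) = L₂ := by
      rw [List.drop_length_add_append]; rfl
    simp only [htake, hdrop]
    refine ⟨⟨?_, ?_⟩, ?_⟩
    · rw [mem_colLists]
      constructor
      · intro q hq
        simp only [List.mem_append] at hq
        simp only [List.length_cons]
        rcases hq with hq | hq | hq
        · have := hL.1 q (by simp [hq]); omega
        · have := hM.1 q hq; omega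
        · have := hL.1 q (by simp [hq]); omega
      · have h1 := hL.2
        have h2 := hM.2
        simp only [List.map_append, List.map_cons, List.sum_append, List.sum_cons] at h1 ⊢
        omega
    · simp only [List.length_append]; omega
    · have := List.length_pos_of_ne_nil hc.2.2.2
      omega
  · rintro ⟨⟨L, a⟩, M⟩ hx hne ⟨⟨L', a'⟩, M'⟩ hx' hne' heq
    simp only [Finset.mem_sigma, Finset.mem_range] at hx hx'
    obtain ⟨⟨hL, ha⟩, hM⟩ := hx
    obtain ⟨⟨hL', ha'⟩, hM'⟩ := hx'
    simp only [Sigma.mk.injEq, heq_eq_eq] at heq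
    obtain ⟨⟨heq, hlen⟩, rfl⟩ := heq
    obtain ⟨L₁, c, L₂, rfl, rfl⟩ : ∃ L₁ c L₂, L = L₁ ++ c :: L₂ ∧ a = L₁.length :=
      ⟨L.take a, L[a], L.drop (a + 1), by simp, by simp [ha.le]⟩
    obtain ⟨L₁', c', L₂', rfl, hlen₁⟩ :
        ∃ L₁' c' L₂', L' = L₁' ++ c' :: L₂' ∧ L₁.length = L₁'.length :=
      ⟨L'.take L₁.length, L'[L₁.length], L'.drop (L₁.length + 1), by simp, by simp [ha'.le]⟩
    have htake : (L₁ ++ c :: L₂).take L₁.length = L₁ := List.take_left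
    have hdrop : (L₁ ++ c :: L₂).drop (L₁.length + 1) = L₂ := by
      rw [List.drop_length_add_append]; rfl
    have htake' : (L₁' ++ c' :: L₂').take L₁.length = L₁' := by rw [hlen₁]; exact List.take_left
    have hdrop' : (L₁' ++ c' :: L₂').drop (L₁.length + 1) = L₂' := by
      rw [hlen₁, List.drop_length_add_append]; rfl
    rw [htake, hdrop, htake', hdrop'] at heq
    obtain ⟨rfl, heq₂⟩ := List.append_inj heq hlen₁
    obtain ⟨rfl, rfl⟩ := List.append_inj heq₂ (by omega)
    simp only [List.getD_append_right _ _ _ _ le_rfl, Nat.sub_self, List.getD_cons_zero]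
      at hne hne'
    have h1 := of_colCoeff_ne_zero (right_ne_zero_of_mul (left_ne_zero_of_smul hne))
    have h2 := of_colCoeff_ne_zero (right_ne_zero_of_mul (left_ne_zero_of_smul hne'))
    have : c = c' := by
      ext
      · omega
      · omega
    rw [this]
  · rintro ⟨⟨L, b⟩, a⟩ hx hne
    simp only [Finset.mem_sigma, Finset.mem_range] at hx
    obtain ⟨⟨hL, hb⟩, ha⟩ := hx
    obtain ⟨L₁, M, L₂, rfl, rfl, rfl⟩ : ∃ L₁ M L₂, L = L₁ ++ (M ++ L₂) ∧ a = L₁.length ∧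
        b = L₁.length + M.length := by
      refine ⟨L.take a, (L.take b).drop a, L.drop b, ?_, ?_, ?_⟩
      · rw [← List.append_assoc]
        conv_lhs => rw [← List.take_append_drop b L]
        congr 1
        conv_lhs => rw [← List.take_append_drop a (L.take b)]
        rw [List.take_take, min_eq_left ha.le]
      · simp; omega
      · simp; omega
    have hB : ((L₁ ++ (M ++ L₂)).take (L₁.length + M.length)).drop L₁.length = M := by
      rw [List.take_length_add_append, List.drop_left, List.take_left]
    have hd : (L₁ ++ (M ++ L₂)).drop (L₁.length + M.length) = L₂ := by
      rw [List.drop_length_add_append, List.drop_left]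
    have hst := left_ne_zero_of_smul hne
    have hst0 := hst
    unfold stepTerm at hst
    simp only [hB, hd, List.take_left] at hst
    split_ifs at hst with hc
    swap
    · exact absurd rfl hst
    set c : ℕ × ℕ := ((M.map Prod.fst).sum - ik, (M.map fun q => q.2 - 1).sum) with hcdef
    have hT := right_ne_zero_of_mul (left_ne_zero_of_mul hst)
    have hcol : colCoeff ik c M ≠ 0 := by
      rw [colCoeff, if_pos ⟨hc.2.2, rfl⟩]
      exact mul_ne_zero (left_ne_zero_of_mul (left_ne_zero_of_mul hst)) (right_ne_zero_of_mul hst)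
    have htake : (L₁ ++ c :: L₂).take L₁.length = L₁ := List.take_left
    have hdrop : (L₁ ++ c :: L₂).drop (L₁.length + 1) = L₂ := by
      rw [List.drop_length_add_append]; rfl
    have hget : (L₁ ++ c :: L₂).getD L₁.length (0, 0) = c := by
      rw [List.getD_append_right _ _ _ _ le_rfl]; simp
    have hc1 : c.1 + ik = (M.map Prod.fst).sum := Nat.sub_add_cancel hc.1.le
    rw [mem_colLists] at hL
    refine ⟨⟨⟨L₁ ++ c :: L₂, L₁.length⟩, M⟩, ?_, ?_, ?_⟩
    · simp only [Finset.mem_sigma, Finset.mem_range, hget]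
      refine ⟨⟨?_, by simp⟩, ?_⟩
      · rw [mem_colLists]
        constructor
        · intro q hq
          refine ⟨?_, snd_lt_of_TRev_ne_zero hT q hq⟩
          simp only [List.mem_append, List.mem_cons] at hq
          rcases hq with hq | rfl | hq
          · exact (hL.1 q (by simp [hq])).1
          · simp only [hcdef]; omega
          · exact (hL.1 q (by simp [hq])).1
        · exact sum_fst_of_TRev_ne_zero hT
      · rw [mem_colLists]
        exact ⟨fun q hq => hL.1 q (by simp [hq]), hc1.symm⟩
    · simp only [hget, htake, hdrop]
      rw [← key L₁ M L₂ c hcol (by omega) hT]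
      exact hne
    · simp only [htake, hdrop]
  · rintro ⟨⟨L, a⟩, M⟩ hx hne
    simp only [Finset.mem_sigma, Finset.mem_range] at hx
    obtain ⟨⟨hL, ha⟩, hM⟩ := hx
    obtain ⟨L₁, c, L₂, rfl, rfl⟩ : ∃ L₁ c L₂, L = L₁ ++ c :: L₂ ∧ a = L₁.length :=
      ⟨L.take a, L[a], L.drop (a + 1), by simp, by simp [ha.le]⟩
    have htake : (L₁ ++ c :: L₂).take L₁.length = L₁ := List.take_left
    have hdrop : (L₁ ++ c :: L₂).drop (L₁.length + 1) = L₂ := by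
      rw [List.drop_length_add_append]; rfl
    simp only [List.getD_append_right _ _ _ _ le_rfl, Nat.sub_self, List.getD_cons_zero, htake,
      hdrop] at hne ⊢
    have h1 := left_ne_zero_of_smul hne
    rw [key L₁ M L₂ c (right_ne_zero_of_mul h1)
      ((mem_colLists.1 hL).1 c (by simp)).1 (left_ne_zero_of_mul h1)]

/-- Higher derivatives `E_{i_k} ⋯ E_{i_1} F` as polynomials in the `∂₀ˡ E_s F`, with the constants
`T` as coefficients. -/
theorem foldr_eq_sum_TRev (hcomm : ∀ i x, E i (d x) = d (E i x))
    (hE : ∀ i j, 0 < i → 0 < j → E j (E i F) =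
      ∑ p ∈ posLists (i + j), T₂ i j p • (p.map fun s => d (E s F)).prod)
    (R : List ℕ) (hR : R ≠ []) (hpos : ∀ i ∈ R, 0 < i) :
    R.foldr (fun i x => E i x) F =
      ∑ L ∈ colLists R.sum R.length, TRev R L • (L.map (colVal d E F)).prod := by
  induction R, hR using two_le_length_induction with
  | h1 i =>
    rw [Finset.sum_eq_single [(i, 0)]]
    · simp [TRev, colVal]
    · intro L _ hL
      rw [TRev, if_neg hL, zero_smul]
    · intro h
      exact absurd (mem_colLists.2 (by simp [hpos])) h
  | h2 j i =>
    have := apply_colVal hcomm hE (hpos j (by simp)) (c := (i, 0)) (hpos i (by simp)) (K := 2)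
      (by simp)
    simp only [colVal, Function.iterate_zero, id_eq] at this
    simp only [List.foldr_cons, List.foldr_nil, this, List.sum_cons, List.sum_nil,
      List.length_cons, List.length_nil, add_zero, zero_add, add_comm j i]
    refine Finset.sum_congr rfl fun L _ => ?_
    congr 1
    rw [TRev, colCoeff]
    have h1 : (∀ q ∈ L, q.2 = 1) ↔ (∀ q ∈ L, 1 ≤ q.2) ∧ (L.map fun q => q.2 - 1).sum = 0 := by
      simp only [List.sum_eq_zero_iff, List.mem_map, forall_exists_index, and_imp,
        forall_apply_eq_imp_iff₂]
      constructor
      · intro h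
        exact ⟨fun q hq => (h q hq).ge, fun q hq => by simp [h q hq]⟩
      · rintro ⟨h, h'⟩ q hq
        have := h q hq
        have := h' q hq
        omega
    simp only [h1]
    split_ifs with h
    · have : (L.map fun q => (q.2 - 1).factorial).prod = 1 := by
        apply List.prod_eq_one
        intro x hx
        obtain ⟨q, hq, rfl⟩ := List.mem_map.1 hx
        rw [h1.2 h q hq]; rfl
      rw [this]; simp
    · rfl
  | h3 ik R hR _ ih =>
    rw [List.foldr_cons, ih fun i hi => hpos i (by simp [hi]), map_sum]
    simp only [Derivation.map_smul]
    exact sum_TRev_step hR fun c hc K hK =>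
      apply_colVal hcomm hE (hpos ik (by simp)) hc hK

end Expansion

/-! ### Several derivations applied to a product -/

section Distribution

/-- The members of `J` whose positions are mapped to `a` by `g`. -/
def block {m : ℕ} (J : List ℕ) (g : Fin J.length → Fin m) (a : Fin m) : List ℕ :=
  ((List.finRange J.length).filter fun b => g b = a).map J.get

lemma block_cons {m : ℕ} (j : ℕ) (J : List ℕ) (a₀ : Fin m) (g : Fin J.length → Fin m)
    (a : Fin m) :
    block (j :: J) (Fin.cons (α := fun _ => Fin m) a₀ g : Fin (J.length + 1) → Fin m) a =
      if a = a₀ then j :: block J g a else block J g a := by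
  have h : (List.finRange J.length).map (fun b => (j :: J).get b.succ) =
      (List.finRange J.length).map J.get := rfl
  simp only [block, List.length_cons, List.finRange_succ, List.filter_cons, Fin.cons_zero,
    List.filter_map, eq_comm (a := a) (b := a₀)]
  split_ifs with h1 h2 h2
  · simp [Function.comp_def]
  · simp_all
  · simp_all
  · simp [Function.comp_def]

lemma sum_map_filter {ι : Type*} (p : ι → Prop) [DecidablePred p] (f : ι → ℕ) (l : List ι) :
    ((l.filter fun x => p x).map f).sum = (l.map fun x => if p x then f x else 0).sum := by
  induction l with
  | nil => rfl
  | cons x l ih =>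
    by_cases h : p x <;> simp [h, ih]

lemma sum_block {m : ℕ} (J : List ℕ) (g : Fin J.length → Fin m) (a : Fin m) :
    (block J g a).sum = ∑ b ∈ Finset.univ.filter (fun b => g b = a), J.get b := by
  rw [Finset.sum_filter, Fin.sum_univ_def, block, sum_map_filter]

lemma length_block {m : ℕ} (J : List ℕ) (g : Fin J.length → Fin m) (a : Fin m) :
    (block J g a).length = (Finset.univ.filter (fun b => g b = a)).card := by
  rw [Finset.card_eq_sum_ones, Finset.sum_filter, Fin.sum_univ_def, block, List.length_map,
    ← sum_map_filter]
  simp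

lemma mem_of_mem_block {m : ℕ} {J : List ℕ} {g : Fin J.length → Fin m} {a : Fin m} {x : ℕ}
    (h : x ∈ block J g a) : x ∈ J := by
  obtain ⟨b, -, rfl⟩ := List.mem_map.1 h
  exact List.get_mem _ _

variable {S : Type*} [CommRing S] [Algebra ℚ S]

lemma derivation_prod {ι : Type*} [DecidableEq ι] (D : Derivation ℚ S S) (s : Finset ι)
    (y : ι → S) :
    D (∏ a ∈ s, y a) = ∑ a₀ ∈ s, ∏ a ∈ s, if a = a₀ then D (y a) else y a := by
  induction s using Finset.induction_on with
  | empty => simp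
  | insert i s hi ih =>
    rw [Finset.prod_insert hi, Finset.sum_insert hi, Finset.prod_insert hi, if_pos rfl,
      Derivation.leibniz, smul_eq_mul, smul_eq_mul, ih, add_comm, Finset.mul_sum]
    congr 1
    · rw [mul_comm]
      congr 1
      refine Finset.prod_congr rfl fun a ha => ?_
      rw [if_neg]; rintro rfl; exact hi ha
    · refine Finset.sum_congr rfl fun a₀ ha => ?_
      rw [Finset.prod_insert hi, if_neg]
      rintro rfl; exact hi ha

/-- Applying several derivations to a product: the derivations are distributed over the factors in
all possible ways. -/
lemma foldr_prod {m : ℕ} (E : ℕ → Derivation ℚ S S) (J : List ℕ) (y : Fin m → S) :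
    J.foldr (fun j x => E j x) (∏ a, y a) =
      ∑ g : Fin J.length → Fin m, ∏ a, (block J g a).foldr (fun j x => E j x) (y a) := by
  induction J with
  | nil => simp [block]
  | cons j J ih =>
    refine Eq.trans ?_ ((Fin.consEquiv fun _ : Fin (J.length + 1) => Fin m).sum_comp
      fun g => ∏ a, (block (j :: J) g a).foldr (fun j x => E j x) (y a))
    rw [List.foldr_cons, ih, map_sum, Fintype.sum_prod_type, Finset.sum_comm]
    refine Finset.sum_congr rfl fun g _ => ?_
    rw [derivation_prod]
    refine Finset.sum_congr rfl fun a₀ _ => Finset.prod_congr rfl fun a _ => ?_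
    have := block_cons j J a₀ g a
    refine Eq.trans ?_ (congrArg (fun B => B.foldr (fun j x => E j x) (y a)) this).symm
    split_ifs <;> rfl

end Distribution

/-! ### Derivatives on the line where all times vanish -/

section Restriction

lemma P_singleton {i j : ℕ} (hi : 0 < i) (hj : 0 < j) : P i j [i + j] = 1 := by
  rw [P, Finset.card_eq_one]
  refine ⟨(fun _ => i, fun _ => j), ?_⟩
  ext ⟨x, y⟩
  simp only [Finset.mem_filter, Finset.mem_product, Finset.Nat.mem_antidiagonalTuple,
    Finset.mem_singleton, Prod.mk.injEq]
  have hu : ∀ z : Fin [i + j].length → ℕ, ∑ a, z a = z 0 := fun z => Fin.sum_univ_one z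
  rw [hu, hu]
  constructor
  · rintro ⟨⟨h1, h2⟩, -⟩
    constructor
    · funext a; rw [← h1]; congr 1; exact Subsingleton.elim (α := Fin 1) a 0
    · funext a; rw [← h2]; congr 1; exact Subsingleton.elim (α := Fin 1) a 0
  · rintro ⟨rfl, rfl⟩
    refine ⟨⟨rfl, rfl⟩, fun a => ⟨hi, hj, ?_⟩⟩
    have : a = 0 := Subsingleton.elim (α := Fin 1) a 0
    subst this; rfl

lemma T₂_singleton {i j : ℕ} (hi : 0 < i) (hj : 0 < j) : T₂ i j [i + j] = 1 := by
  rw [T₂, Finset.sum_eq_single (Composition.single [i + j].length one_pos)]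
  · have : ([i + j].splitWrtComposition (Composition.single [i + j].length one_pos)) =
        [[i + j]] := by
      simp [List.splitWrtComposition, List.splitWrtCompositionAux]
    rw [this]
    simp [P_singleton hi hj]
  · intro c _ hc
    exfalso
    apply hc
    rw [Composition.eq_single_iff_length]
    have h1 := c.length_le
    have h2 := c.length_pos_iff.2 one_pos
    simp only [List.length_singleton] at h1
    omega
  · intro h; exact absurd (Finset.mem_univ _) h

/-- The only monomial with a single column has coefficient `1`. -/
lemma TRev_singleton (R : List ℕ) (hR : R ≠ []) (hpos : ∀ i ∈ R, 0 < i) :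
    TRev R [(R.sum, R.length - 1)] = 1 := by
  induction R, hR using two_le_length_induction with
  | h1 i => simp [TRev]
  | h2 j i =>
    rw [TRev, if_pos (by simp)]
    simp only [List.map_cons, List.map_nil, List.sum_cons, List.sum_nil, add_zero]
    rw [add_comm]
    exact T₂_singleton (hpos i (by simp)) (hpos j (by simp))
  | h3 ik R hR _ ih =>
    have hposR : ∀ i ∈ R, 0 < i := fun i hi => hpos i (by simp [hi])
    have hsum : 0 < R.sum := by
      have := length_le_sum_of_pos hposR
      omega
    rw [TRev_step hR]
    simp only [List.length_singleton]
    rw [Finset.sum_range_succ, Finset.sum_range_succ, Finset.sum_range_zero,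
      Finset.sum_range_succ, Finset.sum_range_zero, Finset.sum_range_zero, zero_add, zero_add]
    unfold stepTerm
    simp only [List.sum_cons, List.length_cons, Nat.add_sub_cancel, List.take_succ_cons,
      List.take_zero, List.drop_zero, List.map_cons, List.map_nil, List.sum_nil, add_zero,
      Nat.add_sub_cancel_left, List.prod_cons, List.prod_nil, mul_one, List.nil_append,
      List.drop_succ_cons, List.drop_nil, ih hposR]
    rw [if_pos ⟨by omega, by omega, by simp; omega⟩, add_comm ik,
      T₂_singleton hsum (hpos ik (by simp)), div_self (by positivity)]
    norm_num

lemma eq_singleton_of_TRev_ne_zero {R : List ℕ} {c : ℕ × ℕ} (h : TRev R [c] ≠ 0) :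
    c = (R.sum, R.length - 1) := by
  have h1 := sum_fst_of_TRev_ne_zero h
  have h2 := sum_snd_of_TRev_ne_zero h
  simp only [List.map_cons, List.map_nil, List.sum_cons, List.sum_nil, add_zero,
    List.length_singleton] at h1 h2
  ext
  · exact h1
  · simp only; omega

variable {S A : Type*} [CommRing S] [Algebra ℚ S] [CommRing A] [Algebra ℚ A]
  {d : Derivation ℚ S S} {δ : Derivation ℚ A A} {E E' : ℕ → Derivation ℚ S S} {F : S} {f : A}
  {ev : S →ₐ[ℚ] A}

lemma comp_iterate {X Y : Type*} {ev : X → Y} {d : X → X} {δ : Y → Y}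
    (h : ∀ x, ev (d x) = δ (ev x)) (l : ℕ) (x : X) : ev (d^[l] x) = δ^[l] (ev x) :=
  (Function.Semiconj.iterate_right (f := ev) h l).eq x

/-- The derivative `E_s E'_B F` on the line where all times vanish. -/
lemma ev_apply_foldr (hev : ∀ x, ev (d x) = δ (ev x))
    (hcomm : ∀ i x, E i (d x) = d (E i x)) (hcomm' : ∀ i x, E' i (d x) = d (E' i x))
    (hE' : ∀ i j, 0 < i → 0 < j → E' j (E' i F) =
      ∑ p ∈ posLists (i + j), T₂ i j p • (p.map fun s => d (E' s F)).prod)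
    (hmix : ∀ i j, 0 < i → 0 < j → ev (E i (E' j F)) = if i = j then (i : ℚ)⁻¹ • f ^ i else 0)
    (hsym' : ∀ i, ev (E' i F) = 0) {s : ℕ} (hs : 0 < s) {B : List ℕ} (hB : B ≠ [])
    (hpos : ∀ i ∈ B, 0 < i) :
    ev (E s (B.foldr (fun i x => E' i x) F)) =
      if B.sum = s then (s : ℚ)⁻¹ • δ^[B.length - 1] (f ^ s) else 0 := by
  have hcol : ∀ q, ev (colVal d E' F q) = 0 := by
    intro q
    rw [colVal, comp_iterate hev, hsym', iterate_map_zero]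
  have hlen : 0 < B.sum := by
    have h1 := length_le_sum_of_pos hpos
    have := List.length_pos_of_ne_nil hB
    omega
  -- a derivation of a product of at least two factors `∂₀ˡ E'_s F` vanishes on the line
  rw [foldr_eq_sum_TRev hcomm' hE' B hB hpos, map_sum, map_sum,
    Finset.sum_eq_single [(B.sum, B.length - 1)]]
  · rw [TRev_singleton B hB hpos, one_smul, List.map_singleton, List.prod_singleton, colVal,
      comp_iterate (ev := E s) (δ := d) (hcomm s), comp_iterate hev, hmix _ _ hs hlen]
    simp only [eq_comm (a := s)]
    split_ifs with h
    · have : ∀ l x, δ^[l] x = ((δ : A →ₗ[ℚ] A) ^ l) x := by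
        intro l x; rw [Module.End.pow_apply]; rfl
      simp only [this, map_smul]
    · rw [iterate_map_zero]
  · intro L hL hne
    rw [Derivation.map_smul, map_smul]
    by_cases hT : TRev B L = 0
    · rw [hT, zero_smul]
    match L with
    | [] =>
      have := (mem_colLists.1 hL).2
      simp only [List.map_nil, List.sum_nil] at this
      omega
    | [c] => exact absurd (by rw [eq_singleton_of_TRev_ne_zero hT]) hne
    | c :: c' :: L =>
      simp only [List.map_cons, List.prod_cons, Derivation.leibniz, smul_eq_mul, map_add, map_mul,
        hcol, zero_mul, add_zero, smul_zero]
  · intro h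
    exact absurd (mem_colLists.2 (by simp [hlen]; exact List.length_pos_of_ne_nil hB)) h

/-- The contribution of one factor `∂₀ˡ E_s F` of a product that receives the barred derivatives
with indices in `B`. -/
lemma ev_foldr_colVal (hev : ∀ x, ev (d x) = δ (ev x))
    (hcomm : ∀ i x, E i (d x) = d (E i x)) (hcomm' : ∀ i x, E' i (d x) = d (E' i x))
    (hEE' : ∀ i j x, E i (E' j x) = E' j (E i x))
    (hE' : ∀ i j, 0 < i → 0 < j → E' j (E' i F) =
      ∑ p ∈ posLists (i + j), T₂ i j p • (p.map fun s => d (E' s F)).prod)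
    (hmix : ∀ i j, 0 < i → 0 < j → ev (E i (E' j F)) = if i = j then (i : ℚ)⁻¹ • f ^ i else 0)
    (hsym : ∀ i, ev (E i F) = 0) (hsym' : ∀ i, ev (E' i F) = 0) {q : ℕ × ℕ} (hq : 0 < q.1)
    {B : List ℕ} (hpos : ∀ i ∈ B, 0 < i) :
    ev (B.foldr (fun i x => E' i x) (colVal d E F q)) =
      if 0 < B.length ∧ B.sum = q.1 then (q.1 : ℚ)⁻¹ • δ^[q.2 + B.length - 1] (f ^ q.1) else 0 := by
  have h1 : ∀ B : List ℕ, B.foldr (fun i x => E' i x) (colVal d E F q) =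
      d^[q.2] (E q.1 (B.foldr (fun i x => E' i x) F)) := by
    intro B
    induction B with
    | nil => rfl
    | cons j B ih =>
      rw [List.foldr_cons, ih, List.foldr_cons, comp_iterate (ev := E' j) (hcomm' j), hEE']
  have hδ : ∀ l x, δ^[l] x = ((δ : A →ₗ[ℚ] A) ^ l) x := by
    intro l x; rw [Module.End.pow_apply]; rfl
  rw [h1, comp_iterate hev]
  rcases eq_or_ne B [] with rfl | hB
  · rw [List.foldr_nil, hsym, iterate_map_zero, if_neg (by simp)]
  have hl := List.length_pos_of_ne_nil hB
  rw [ev_apply_foldr hev hcomm hcomm' hE' hmix hsym' hq hB hpos]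
  simp only [hl, true_and]
  split_ifs with h
  · simp only [hδ, map_smul]
    rw [← Module.End.mul_apply, ← pow_add, Nat.add_sub_assoc hl]
  · rw [iterate_map_zero]

/-- Lists of columns are compositions together with a tuple of exponents. -/
lemma sum_colLists {M : Type*} [AddCommMonoid M] (n K : ℕ) (G : List (ℕ × ℕ) → M) :
    ∑ L ∈ colLists n K, G L = ∑ c : Composition n,
      ∑ l ∈ Fintype.piFinset fun _ : Fin c.length => Finset.range K,
        G (List.ofFn fun a => (c.blocksFun a, l a)) := by
  rw [Finset.sum_sigma']
  symm
  refine Finset.sum_bij (fun x _ => List.ofFn fun a => (x.1.blocksFun a, x.2 a)) ?_ ?_ ?_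
    fun _ _ => rfl
  · rintro ⟨c, l⟩ h
    simp only [Finset.mem_sigma, Finset.mem_univ, true_and, Fintype.mem_piFinset,
      Finset.mem_range] at h
    rw [mem_colLists]
    simp only [List.forall_mem_ofFn_iff, List.map_ofFn, List.sum_ofFn, Function.comp_apply]
    exact ⟨fun a => ⟨c.one_le_blocksFun a, h a⟩, c.sum_blocksFun⟩
  · rintro ⟨c, l⟩ _ ⟨c', l'⟩ _ h
    have h1 := congrArg (List.map Prod.fst) h
    simp only [List.map_ofFn, Function.comp_def] at h1
    have hc : c = c' := by
      apply Composition.ext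
      rw [← c.ofFn_blocksFun, ← c'.ofFn_blocksFun]
      exact h1
    subst hc
    have h2 := List.ofFn_injective h
    congr 1
    funext a
    exact congrArg Prod.snd (congrFun h2 a)
  · intro L hL
    rw [mem_colLists] at hL
    let c : Composition n := ⟨L.map Prod.fst, fun {x} hx => by
      obtain ⟨q, hq, rfl⟩ := List.mem_map.1 hx
      exact (hL.1 q hq).1, hL.2⟩
    have hlen : c.length = L.length := List.length_map ..
    refine ⟨⟨c, fun a => (L.get (a.cast hlen)).2⟩, ?_, ?_⟩
    · simp only [Finset.mem_sigma, Finset.mem_univ, true_and, Fintype.mem_piFinset,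
        Finset.mem_range]
      exact fun a => (hL.1 _ (List.get_mem _ _)).2
    · apply List.ext_getElem
      · simp [hlen]
      · intro a h1 h2
        simp [c, Composition.blocksFun]

lemma foldr_sum_smul {ι : Type*} (J : List ℕ) (X : Finset ι) (t : ι → ℚ) (y : ι → S) :
    J.foldr (fun j x => E j x) (∑ L ∈ X, t L • y L) =
      ∑ L ∈ X, t L • J.foldr (fun j x => E j x) (y L) := by
  induction J with
  | nil => rfl
  | cons j J ih => simp only [List.foldr_cons, ih, map_sum, Derivation.map_smul]

lemma sum_length_block {m : ℕ} (J : List ℕ) (g : Fin J.length → Fin m) :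
    ∑ a, (block J g a).length = J.length := by
  simp only [length_block]
  rw [← Finset.card_eq_sum_card_fiberwise fun _ _ => Finset.mem_univ _, Finset.card_fin]

lemma sum_sum_block {m : ℕ} (J : List ℕ) (g : Fin J.length → Fin m) :
    ∑ a, (block J g a).sum = J.sum := by
  simp only [sum_block]
  rw [Finset.sum_fiberwise, ← List.sum_ofFn, List.ofFn_get]

/-- `NTilde` in terms of the blocks of `J`, with the factor `1 / (s₁ ⋯ s_m)` inside of the sum. -/
lemma NTilde_eq {I J : List ℕ} {m : ℕ} (s r : Fin m → ℕ) :
    NTilde I J s r = ((I.prod * J.prod : ℕ) : ℚ) * ∑ g : Fin J.length → Fin m,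
      if (∀ a, 0 < (block J g a).length ∧ (block J g a).sum = s a) ∧
          ∀ a, (block J g a).length ≤ r a + 1 then
        (∏ a, (s a : ℚ)⁻¹) * T I (List.ofFn fun a => (s a, r a + 1 - (block J g a).length))
      else 0 := by
  rw [NTilde, div_mul_eq_mul_div, mul_div_assoc]
  congr 1
  rw [Finset.sum_div]
  refine Finset.sum_congr rfl fun g _ => ?_
  simp only [length_block, sum_block, forall_and, and_assoc]
  split_ifs
  · rw [Finset.prod_inv_distrib, div_eq_inv_mul]; push_cast; rfl
  · rw [zero_div]

lemma NTilde_eq_zero {I J : List ℕ} {m : ℕ} {s : Fin m → ℕ} (r : Fin m → ℕ)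
    (h : ∑ a, s a ≠ J.sum) : NTilde I J s r = 0 := by
  rw [NTilde_eq, Finset.sum_eq_zero, mul_zero]
  intro g _
  rw [if_neg]
  rintro ⟨hg, -⟩
  apply h
  rw [← sum_sum_block J g]
  exact Finset.sum_congr rfl fun a _ => ((hg a).2).symm

/-- The mixed derivatives of `F` on the line where all times vanish. All that is used about `F` are
the formulas for `E_j E_i F` and `E'_j E'_i F`, which come from the two unmixed Hirota equations,
and the values of `E_i F`, `E'_i F` and `E_i E'_j F` on that line. -/
theorem ev_foldr_foldr (hev : ∀ x, ev (d x) = δ (ev x))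
    (hcomm : ∀ i x, E i (d x) = d (E i x)) (hcomm' : ∀ i x, E' i (d x) = d (E' i x))
    (hEE' : ∀ i j x, E i (E' j x) = E' j (E i x))
    (hE : ∀ i j, 0 < i → 0 < j → E j (E i F) =
      ∑ p ∈ posLists (i + j), T₂ i j p • (p.map fun s => d (E s F)).prod)
    (hE' : ∀ i j, 0 < i → 0 < j → E' j (E' i F) =
      ∑ p ∈ posLists (i + j), T₂ i j p • (p.map fun s => d (E' s F)).prod)
    (hmix : ∀ i j, 0 < i → 0 < j → ev (E i (E' j F)) = if i = j then (i : ℚ)⁻¹ • f ^ i else 0)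
    (hsym : ∀ i, ev (E i F) = 0) (hsym' : ∀ i, ev (E' i F) = 0) {I J : List ℕ} (hI : I ≠ [])
    (hIpos : ∀ i ∈ I, 0 < i) (hJpos : ∀ j ∈ J, 0 < j) :
    ((I.prod * J.prod : ℕ) : ℚ) •
        ev (J.foldr (fun j x => E' j x) (I.reverse.foldr (fun i x => E i x) F)) =
      ∑ c : Composition I.sum,
        ∑ r ∈ Finset.Nat.antidiagonalTuple c.length (I.length + J.length - 2),
          NTilde I J c.blocksFun r • ∏ a, δ^[r a] (f ^ c.blocksFun a) := by
  classical
  have hIlen := List.length_pos_of_ne_nil hI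
  rw [foldr_eq_sum_TRev hcomm hE I.reverse (by simpa using hI) (by simpa using hIpos),
    foldr_sum_smul, map_sum, List.sum_reverse, List.length_reverse, sum_colLists, Finset.smul_sum]
  refine Finset.sum_congr rfl fun c _ => ?_
  set K := I.length with hK
  set n : (Fin J.length → Fin c.length) → Fin c.length → ℕ := fun g a => (block J g a).length
    with hn
  set good : (Fin J.length → Fin c.length) → Prop := fun g =>
    ∀ a, 0 < (block J g a).length ∧ (block J g a).sum = c.blocksFun a with hgood
  have hval : ∀ l : Fin c.length → ℕ,
      ev (J.foldr (fun j x => E' j x)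
        ((List.ofFn fun a => (c.blocksFun a, l a)).map (colVal d E F)).prod) =
      ∑ g : Fin J.length → Fin c.length, if good g then
        (∏ a, (c.blocksFun a : ℚ)⁻¹) • ∏ a, δ^[l a + n g a - 1] (f ^ c.blocksFun a) else 0 := by
    intro l
    rw [List.map_ofFn, List.prod_ofFn, foldr_prod, map_sum]
    refine Finset.sum_congr rfl fun g _ => ?_
    rw [map_prod]
    have : ∀ a, ev ((block J g a).foldr (fun j x => E' j x)
        ((colVal d E F ∘ fun a => (c.blocksFun a, l a)) a)) = _ := fun a =>
      ev_foldr_colVal hev hcomm hcomm' hEE' hE' hmix hsym hsym' (q := (c.blocksFun a, l a))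
        (c.one_le_blocksFun a) (B := block J g a) fun i hi => hJpos i (mem_of_mem_block hi)
    simp only [this]
    by_cases hg : good g
    · rw [if_pos hg, ← Finset.prod_smul]
      refine Finset.prod_congr rfl fun a _ => ?_
      rw [if_pos (hg a)]
    · rw [if_neg hg]
      obtain ⟨a, ha⟩ := not_forall.1 hg
      exact Finset.prod_eq_zero (Finset.mem_univ a) (if_neg ha)
  have hL : ∀ l : Fin c.length → ℕ,
      ev (TRev I.reverse (List.ofFn fun a => (c.blocksFun a, l a)) •
        J.foldr (fun j x => E' j x)
          ((List.ofFn fun a => (c.blocksFun a, l a)).map (colVal d E F)).prod) =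
      ∑ g : Fin J.length → Fin c.length, if good g then
        (T I (List.ofFn fun a => (c.blocksFun a, l a)) * ∏ a, (c.blocksFun a : ℚ)⁻¹) •
          ∏ a, δ^[l a + n g a - 1] (f ^ c.blocksFun a) else 0 := by
    intro l
    rw [map_smul, hval, Finset.smul_sum]
    refine Finset.sum_congr rfl fun g _ => ?_
    rw [smul_ite, smul_zero, smul_smul]
    rfl
  rw [Finset.sum_congr rfl fun l _ => hL l, Finset.sum_comm]
  simp only [NTilde_eq, mul_smul ((I.prod * J.prod : ℕ) : ℚ), ← Finset.smul_sum]
  congr 1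
  simp only [Finset.sum_smul]
  conv_rhs => rw [Finset.sum_comm]
  refine Finset.sum_congr rfl fun g _ => ?_
  by_cases hg : good g
  swap
  · rw [Finset.sum_eq_zero fun l _ => if_neg hg, Finset.sum_eq_zero]
    intro r _
    rw [if_neg fun h => hg h.1, zero_smul]
  have hTsum : ∀ l : Fin c.length → ℕ, T I (List.ofFn fun a => (c.blocksFun a, l a)) ≠ 0 →
      ∑ a, l a + 2 = K + c.length ∧ ∀ a, l a < K := by
    intro l hl
    have h1 := sum_snd_of_TRev_ne_zero hl
    have h2 := snd_lt_of_TRev_ne_zero hl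
    simp only [List.map_ofFn, List.sum_ofFn, Function.comp_apply, List.length_reverse,
      List.length_ofFn, List.forall_mem_ofFn_iff] at h1 h2
    exact ⟨h1, h2⟩
  have hnsum : ∑ a, n g a = J.length := sum_length_block J g
  -- the exponents are related by `r_a = l_a + n_a - 1`
  refine Finset.sum_bij_ne_zero (fun l _ _ a => l a + n g a - 1) ?_ ?_ ?_ ?_
  · intro l _ hne
    rw [if_pos hg] at hne
    have h1 := (hTsum l (left_ne_zero_of_mul (left_ne_zero_of_smul hne))).1
    rw [Finset.Nat.mem_antidiagonalTuple]
    have h3 : ∑ a : Fin c.length, 1 = c.length := by simp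
    have h2 : ∑ a, (l a + n g a - 1) + ∑ a : Fin c.length, 1 = ∑ a, l a + ∑ a, n g a := by
      rw [← Finset.sum_add_distrib, ← Finset.sum_add_distrib]
      refine Finset.sum_congr rfl fun a _ => ?_
      have := (hg a).1
      change 0 < n g a at this
      omega
    omega
  · intro l _ _ l' _ _ h
    funext a
    have h1 := congrFun h a
    have h2 : 0 < n g a := (hg a).1
    change l a + n g a - 1 = l' a + n g a - 1 at h1
    omega
  · intro r hr hne
    split_ifs at hne with hc
    swap
    · exact absurd (zero_smul ..) hne
    have hT := right_ne_zero_of_mul (left_ne_zero_of_smul hne)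
    have hle : ∀ a, n g a ≤ r a + 1 := hc.2
    have hpos : ∀ a, 0 < n g a := fun a => (hg a).1
    have hr' : (fun a => r a + 1 - n g a + n g a - 1) = r := by
      funext a
      have := hle a
      omega
    refine ⟨fun a => r a + 1 - n g a, ?_, ?_, hr'⟩
    · rw [Fintype.mem_piFinset]
      intro a
      rw [Finset.mem_range]
      exact (hTsum _ hT).2 a
    · rw [if_pos hg]
      simp only [congrFun hr']
      rw [mul_comm]
      exact hne
  · intro l _ hne
    have h2 : ∀ a, l a + n g a - 1 + 1 - n g a = l a := by
      intro a
      have : 0 < n g a := (hg a).1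
      omega
    have h3 : (fun a => (c.blocksFun a, l a + n g a - 1 + 1 - n g a)) =
        fun a => (c.blocksFun a, l a) := by
      funext a
      rw [h2]
    have h4 : ∀ a, (block J g a).length ≤ l a + n g a - 1 + 1 := by
      intro a
      change n g a ≤ _
      omega
    rw [if_pos hg, if_pos ⟨hg, h4⟩]
    change _ = (_ * T I (List.ofFn fun a => (c.blocksFun a, l a + n g a - 1 + 1 - n g a))) • _
    rw [h3, mul_comm]

end Restriction

/-! ### The ring of smooth functions on an open set -/

section Smooth

variable (𝕜 K : Type*) [RCLike 𝕜] [RCLike K] [NormedAlgebra 𝕜 K]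

/-- The functions on `U` that are restrictions of functions smooth on `U`. Elements are functions on
the subtype `U`, so that the values outside of `U` of the coefficients of a `TimeSeries` play no
role. -/
def SmoothOn (U : Set 𝕜) : Subalgebra ℚ (U → K) where
  carrier := {g | ∃ h : 𝕜 → K, ContDiffOn 𝕜 ∞ h U ∧ ∀ x : U, g x = h x}
  mul_mem' := by
    rintro g g' ⟨h, hh, hg⟩ ⟨h', hh', hg'⟩
    exact ⟨fun x => h x * h' x, hh.mul hh', fun x => by rw [Pi.mul_apply, hg, hg']⟩
  add_mem' := by
    rintro g g' ⟨h, hh, hg⟩ ⟨h', hh', hg'⟩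
    exact ⟨fun x => h x + h' x, hh.add hh', fun x => by rw [Pi.add_apply, hg, hg']⟩
  algebraMap_mem' := fun q => ⟨fun _ => algebraMap ℚ K q, contDiffOn_const, fun _ => rfl⟩

variable {𝕜 K} {U : Set 𝕜}

/-- The extension of a function on `U` by zero. -/
noncomputable def extendZero (g : U → K) : 𝕜 → K := Function.extend Subtype.val g 0

lemma extendZero_apply (g : U → K) (x : U) : extendZero g x = g x :=
  Subtype.val_injective.extend_apply g 0 x

lemma extendZero_eventuallyEq (hU : IsOpen U) {g : U → K} {h : 𝕜 → K} (hg : ∀ x : U, g x = h x)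
    {x : 𝕜} (hx : x ∈ U) : extendZero g =ᶠ[nhds x] h := by
  filter_upwards [hU.mem_nhds hx] with y hy
  rw [extendZero_apply g ⟨y, hy⟩, hg]

lemma deriv_extendZero (hU : IsOpen U) {g : U → K} {h : 𝕜 → K} (hg : ∀ x : U, g x = h x) (x : U) :
    deriv (extendZero g) x = deriv h x :=
  (extendZero_eventuallyEq hU hg x.2).deriv_eq

lemma differentiableAt_extendZero (hU : IsOpen U) (g : SmoothOn 𝕜 K U) (x : U) :
    DifferentiableAt 𝕜 (extendZero g.1) x := by
  obtain ⟨h, hh, hg⟩ := g.2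
  have : DifferentiableAt 𝕜 h x :=
    (hh.contDiffAt (hU.mem_nhds x.2)).differentiableAt (by simp)
  exact this.congr_of_eventuallyEq (extendZero_eventuallyEq hU hg x.2)

/-- The derivative of a smooth function on `U`. -/
noncomputable def smoothDerivFun (hU : IsOpen U) (g : SmoothOn 𝕜 K U) : SmoothOn 𝕜 K U :=
  ⟨fun x => deriv (extendZero g.1) (x : 𝕜), by
    obtain ⟨h, hh, hg⟩ := g.2
    exact ⟨deriv h, ((contDiffOn_infty_iff_deriv_of_isOpen hU).1 hh).2,
      fun x => deriv_extendZero hU hg x⟩⟩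

lemma smoothDerivFun_apply (hU : IsOpen U) {g : SmoothOn 𝕜 K U} {h : 𝕜 → K}
    (hg : ∀ x : U, g.1 x = h x) (x : U) : (smoothDerivFun hU g).1 x = deriv h x :=
  deriv_extendZero hU hg x

/-- The derivation `∂₀` on the ring of smooth functions. -/
noncomputable def smoothDeriv (hU : IsOpen U) :
    Derivation ℚ (SmoothOn 𝕜 K U) (SmoothOn 𝕜 K U) :=
  Derivation.mk'
    { toFun := smoothDerivFun hU
      map_add' := fun g g' => by
        ext x
        have h := smoothDerivFun_apply hU (g := g + g')
          (h := fun y => extendZero g.1 y + extendZero g'.1 y)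
          (fun y => by rw [extendZero_apply, extendZero_apply]; rfl) x
        rw [deriv_fun_add (differentiableAt_extendZero hU g x)
          (differentiableAt_extendZero hU g' x)] at h
        exact h
      map_smul' := fun q g => by
        ext x
        have h := smoothDerivFun_apply hU (g := q • g)
          (h := fun y => algebraMap ℚ K q * extendZero g.1 y)
          (fun y => by rw [extendZero_apply, ← Algebra.smul_def]; rfl) x
        rw [deriv_const_mul _ (differentiableAt_extendZero hU g x), ← Algebra.smul_def] at h
        exact h }
    fun g g' => by
      ext x
      have h := smoothDerivFun_apply hU (g := g * g')
        (h := fun y => extendZero g.1 y * extendZero g'.1 y)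
        (fun y => by rw [extendZero_apply, extendZero_apply]; rfl) x
      rw [deriv_fun_mul (differentiableAt_extendZero hU g x)
        (differentiableAt_extendZero hU g' x), extendZero_apply, extendZero_apply, add_comm,
        mul_comm _ (g'.1 x)] at h
      exact h

lemma smoothDeriv_apply (hU : IsOpen U) {g : SmoothOn 𝕜 K U} {h : 𝕜 → K}
    (hg : ∀ x : U, g.1 x = h x) (x : U) : (smoothDeriv (K := K) hU g).1 x = deriv h x :=
  smoothDerivFun_apply hU hg x

lemma iterate_smoothDeriv_apply (hU : IsOpen U) {g : SmoothOn 𝕜 K U} {h : 𝕜 → K}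
    (hg : ∀ x : U, g.1 x = h x) (n : ℕ) (x : U) :
    ((smoothDeriv (K := K) hU)^[n] g).1 x = iteratedDeriv n h x := by
  induction n generalizing x with
  | zero => simpa using hg x
  | succ n ih =>
    rw [Function.iterate_succ_apply', smoothDeriv_apply hU ih, iteratedDeriv_succ]

end Smooth

/-! ### Derivations of power series over the times -/

section TimeDerivations

open MvPowerSeries

variable {σ A : Type*} [CommRing A] [Algebra ℚ A]

/-- A derivation of the coefficient ring, applied to each coefficient of a power series. -/
noncomputable def coeffDeriv (δ : Derivation ℚ A A) :
    Derivation ℚ (MvPowerSeries σ A) (MvPowerSeries σ A) :=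
  Derivation.mk'
    { toFun := fun G n => δ (coeff n G)
      map_add' := fun G H => by
        ext n
        change δ (coeff n (G + H)) = δ (coeff n G) + δ (coeff n H)
        rw [map_add, map_add]
      map_smul' := fun q G => by
        ext n
        change δ (q • coeff n G) = q • δ (coeff n G)
        rw [Derivation.map_smul] }
    fun G H => by
      classical
      ext n
      change δ (coeff n (G * H)) =
        coeff n (G * (show MvPowerSeries σ A from fun n => δ (coeff n H)) +
        H * (show MvPowerSeries σ A from fun n => δ (coeff n G)))
      rw [map_add, mul_comm H, coeff_mul, coeff_mul, coeff_mul, map_sum, ← Finset.sum_add_distrib]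
      refine Finset.sum_congr rfl fun p _ => ?_
      rw [Derivation.leibniz, smul_eq_mul, smul_eq_mul, mul_comm (coeff p.2 H)]
      rfl

lemma coeff_coeffDeriv (δ : Derivation ℚ A A) (G : MvPowerSeries σ A) (n : σ →₀ ℕ) :
    coeff n (coeffDeriv δ G) = δ (coeff n G) := rfl

/-- The derivation `E_n = (1/n) ∂_n`, where `∂_n` is the derivative by the time `time n`. By the
convention `0⁻¹ = 0` it is zero for `n = 0`. -/
noncomputable def timeDeriv (A : Type*) [CommRing A] [Algebra ℚ A] (time : ℕ+ → σ) (n : ℕ) :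
    Derivation ℚ (MvPowerSeries σ A) (MvPowerSeries σ A) :=
  (n : ℚ)⁻¹ • (pderiv A (time n.toPNat')).restrictScalars ℚ

lemma timeDeriv_apply (time : ℕ+ → σ) (n : ℕ) (G : MvPowerSeries σ A) :
    timeDeriv A time n G = (n : ℚ)⁻¹ • pderiv A (time n.toPNat') G := rfl

lemma pderiv_comm (τ τ' : σ) (G : MvPowerSeries σ A) :
    pderiv A τ (pderiv A τ' G) = pderiv A τ' (pderiv A τ G) := by
  classical
  ext n
  simp only [coeff_pderiv, add_right_comm n (Finsupp.single τ 1)]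
  by_cases h : τ = τ'
  · subst h; rfl
  · simp [Finsupp.single_eq_of_ne h, Finsupp.single_eq_of_ne (Ne.symm h)]; ring

lemma timeDeriv_comm (time time' : ℕ+ → σ) (n m : ℕ) (G : MvPowerSeries σ A) :
    timeDeriv A time n (timeDeriv A time' m G) = timeDeriv A time' m (timeDeriv A time n G) := by
  simp only [timeDeriv_apply, pderiv_smul_rat]
  rw [smul_comm, pderiv_comm]

lemma timeDeriv_coeffDeriv (δ : Derivation ℚ A A) (time : ℕ+ → σ) (n : ℕ)
    (G : MvPowerSeries σ A) :
    timeDeriv A time n (coeffDeriv δ G) = coeffDeriv δ (timeDeriv A time n G) := by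
  rw [timeDeriv_apply, timeDeriv_apply, Derivation.map_smul]
  congr 1
  ext k
  rw [coeff_pderiv, coeff_coeffDeriv, coeff_coeffDeriv, coeff_pderiv, Derivation.leibniz]
  have : δ ((k (time n.toPNat') : A) + 1) = 0 := by
    rw [map_add, Derivation.map_natCast, Derivation.map_one_eq_zero, add_zero]
  rw [this, smul_zero, zero_add, smul_eq_mul, mul_comm]

/-- The constant coefficient of an iterated partial derivative is a factorial multiple of a
coefficient. -/
lemma constantCoeff_foldr_pderiv [DecidableEq σ] (l : List σ) (G : MvPowerSeries σ A) :
    constantCoeff (l.foldr (fun τ x => pderiv A τ x) G) =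
      ((Multiset.toFinsupp (l : Multiset σ)).prod fun _ n => (n.factorial : A)) *
        coeff (Multiset.toFinsupp (l : Multiset σ)) G := by
  induction l generalizing G with
  | nil => simp
  | cons τ l ih =>
    have hcomm : ∀ l : List σ, pderiv A τ (l.foldr (fun τ x => pderiv A τ x) G) =
        l.foldr (fun τ x => pderiv A τ x) (pderiv A τ G) := by
      intro l
      induction l with
      | nil => rfl
      | cons τ' l ih => rw [List.foldr_cons, pderiv_comm, ih, List.foldr_cons]
    rw [List.foldr_cons, hcomm, ih, coeff_pderiv, ← Multiset.cons_coe, ← Multiset.singleton_add,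
      add_comm ({τ} : Multiset σ) (l : Multiset σ), map_add, Multiset.toFinsupp_singleton]
    set e := Multiset.toFinsupp (l : Multiset σ)
    have h : ∀ e : σ →₀ ℕ, (e.prod fun _ n => (n.factorial : A)) =
        ((e τ).factorial : A) * (e.erase τ).prod fun _ n => (n.factorial : A) :=
      fun e => (Finsupp.mul_prod_erase' e τ (fun _ n => (n.factorial : A)) (by simp)).symm
    rw [h e, h (e + Finsupp.single τ 1), Finsupp.erase_add, Finsupp.erase_single, add_zero,
      Finsupp.add_apply,
      Finsupp.single_eq_same, Nat.factorial_succ]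
    push_cast
    ring

end TimeDerivations

/-! ### From the equations of the hierarchy to relations between derivatives -/

section Equations

open MvPowerSeries

lemma map_expSubst {σ R R' : Type*} [CommRing R] [Algebra ℚ R] [CommRing R'] [Algebra ℚ R']
    (φ : R →+* R') {B : MvPowerSeries σ R} (hB : constantCoeff B = 0) :
    MvPowerSeries.map φ (expSubst B) = expSubst (MvPowerSeries.map φ B) := by
  ext e
  have hB' : constantCoeff (MvPowerSeries.map φ B) = 0 := by
    rw [constantCoeff_map, hB, map_zero]
  rw [coeff_map, coeff_expSubst hB (Nat.lt_succ_self _), coeff_expSubst hB' (Nat.lt_succ_self _),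
    map_sum]
  refine Finset.sum_congr rfl fun n _ => ?_
  rw [← map_pow, coeff_map, map_rat_smul]

lemma expSubst_zero {σ R : Type*} [CommRing R] [Algebra ℚ R] :
    expSubst (0 : MvPowerSeries σ R) = 1 := by
  ext e
  rw [coeff_expSubst (map_zero _) (Nat.lt_succ_self _), Finset.sum_range_succ']
  simp

lemma gexp_eq_expSubst {K : Type*} [RCLike K] {G : MvPowerSeries (Fin 2) (MvPowerSeries Time K)}
    (hG : constantCoeff G = 0) : gexp G = expSubst G := by
  rw [gexp, expWith, hG, expWith]
  simp only [map_zero, sub_zero, NormedSpace.exp_zero, map_one, one_mul]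
  change C (expSubst 0) * _ = _
  rw [expSubst_zero, map_one, one_mul]

lemma map_gexp {K : Type*} [RCLike K] {G : MvPowerSeries (Fin 2) (MvPowerSeries Time K)} {k : K}
    (hG : MvPowerSeries.map constantCoeff G = C k) :
    MvPowerSeries.map constantCoeff (gexp G) = C (NormedSpace.exp k) := by
  have hk : constantCoeff (constantCoeff G) = k := by
    have := congrArg constantCoeff hG
    rwa [constantCoeff_map, constantCoeff_C] at this
  rw [gexp, expWith, map_mul, map_expSubst _ (by simp), map_sub, hG, map_C, map_C, hk, sub_self,
    expSubst_zero, mul_one, expWith, map_mul, constantCoeff_C,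
    constantCoeff_expSubst (by simp), mul_one, hk]

variable {𝕜 K : Type*} [RCLike 𝕜] [RCLike K] [NormedAlgebra 𝕜 K] {U : Set 𝕜}

lemma coeff_genD (time : ℕ+ → Time) (a : Fin 2) (G : GenSeries 𝕜 K) (n : Fin 2 →₀ ℕ)
    (hG : ∀ m : Fin 2 →₀ ℕ, m a ≠ 0 → coeff m G = 0) :
    coeff n (genD time a G) =
      timeDeriv (𝕜 → K) time (n a) (coeff (n - Finsupp.single a (n a)) G) := by
  change ∑ k : Fin (n a), ((k : ℚ) + 1)⁻¹ •
    dt (time (Nat.succPNat k)) (coeff (n - Finsupp.single a ((k : ℕ) + 1)) G) = _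
  rcases Nat.eq_zero_or_pos (n a) with h0 | h0
  · have : IsEmpty (Fin (n a)) := by rw [h0]; infer_instance
    rw [Finset.univ_eq_empty, Finset.sum_empty, h0, timeDeriv_apply]
    simp
  · rw [Finset.sum_eq_single ⟨n a - 1, by omega⟩]
    · have h1 : n a - 1 + 1 = n a := by omega
      have h2 : Nat.succPNat (n a - 1) = (n a).toPNat' := rfl
      simp only [h1, h2, timeDeriv_apply, dt]
      congr 2
      rw [Nat.cast_sub h0]; ring
    · intro k _ hk
      rw [hG, dt, map_zero, smul_zero]
      have : (k : ℕ) ≠ n a - 1 := fun h => hk (Fin.ext h)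
      have := k.2
      simp
      omega
    · intro h; exact absurd (Finset.mem_univ _) h

lemma coeff_C_eq_zero {F : TimeSeries 𝕜 K} {a : Fin 2} (m : Fin 2 →₀ ℕ) (hm : m a ≠ 0) :
    coeff m (C F : GenSeries 𝕜 K) = 0 := by
  classical
  rw [coeff_C, if_neg]
  rintro rfl
  exact hm rfl

lemma sub_single_eq_zero {a b : Fin 2} (hab : a ≠ b) (n : Fin 2 →₀ ℕ) :
    n - Finsupp.single a (n a) = 0 ↔ n b = 0 := by
  rw [Finsupp.ext_iff]
  constructor
  · intro h
    have := h b
    simpa [Finsupp.single_eq_of_ne hab.symm] using this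
  · intro h i
    by_cases hi : i = a
    · subst hi; simp
    · have : i = b := by omega
      subst this
      simp [h]

lemma coeff_genD_C (time : ℕ+ → Time) {a b : Fin 2} (hab : a ≠ b) (F : TimeSeries 𝕜 K)
    (n : Fin 2 →₀ ℕ) :
    coeff n (genD time a (C F)) = if n b = 0 then timeDeriv (𝕜 → K) time (n a) F else 0 := by
  classical
  rw [coeff_genD _ _ _ _ fun m hm => coeff_C_eq_zero m hm, coeff_C]
  simp only [sub_single_eq_zero hab]
  split_ifs <;> simp

lemma coeff_genD_genD_C (time time' : ℕ+ → Time) (F : TimeSeries 𝕜 K) (n : Fin 2 →₀ ℕ) :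
    coeff n (genD time 0 (genD time' 1 (C F))) =
      timeDeriv (𝕜 → K) time (n 0) (timeDeriv (𝕜 → K) time' (n 1) F) := by
  have h10 : (1 : Fin 2) ≠ 0 := by decide
  rw [coeff_genD, coeff_genD_C _ h10, if_pos (by simp)]
  · simp
  · intro m hm
    rw [coeff_genD_C _ h10, if_neg hm]

/-- Evaluation of smooth functions at a point of `U`. -/
noncomputable def evalSmooth (x : U) : SmoothOn 𝕜 K U →+* K :=
  (Pi.evalRingHom (fun _ : U => K) x).comp (SmoothOn 𝕜 K U).val.toRingHom

lemma evalSmooth_apply (x : U) (g : SmoothOn 𝕜 K U) : evalSmooth x g = g.1 x := rfl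

/-- `G` has the same coefficients over `U` as `F`. -/
def IsLift (F : TimeSeries 𝕜 K) (G : MvPowerSeries Time (SmoothOn 𝕜 K U)) : Prop :=
  ∀ n (x : U), (coeff n G).1 x = coeff n F x

lemma IsLift.map_eq {F : TimeSeries 𝕜 K} {G : MvPowerSeries Time (SmoothOn 𝕜 K U)}
    (h : IsLift F G) (x : U) :
    MvPowerSeries.map (Pi.evalRingHom (fun _ : 𝕜 => K) (x : 𝕜)) F =
      MvPowerSeries.map (evalSmooth x) G := by
  ext n
  rw [coeff_map, coeff_map]
  exact (h n x).symm

lemma IsLift.timeDeriv {F : TimeSeries 𝕜 K} {G : MvPowerSeries Time (SmoothOn 𝕜 K U)}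
    (h : IsLift F G) (time : ℕ+ → Time) (n : ℕ) :
    IsLift (timeDeriv (𝕜 → K) time n F) (timeDeriv (SmoothOn 𝕜 K U) time n G) := by
  intro m x
  rw [timeDeriv_apply, timeDeriv_apply]
  change (n : ℚ)⁻¹ • (coeff m (pderiv _ _ G)).1 x = (n : ℚ)⁻¹ • coeff m (pderiv _ _ F) x
  rw [coeff_pderiv, coeff_pderiv]
  congr 1
  change (coeff _ G).1 x * _ = coeff _ F x * _
  rw [h]
  simp

lemma IsLift.d0 (hU : IsOpen U) {F : TimeSeries 𝕜 K} {G : MvPowerSeries Time (SmoothOn 𝕜 K U)}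
    (h : IsLift F G) : IsLift (d0 F) (coeffDeriv (smoothDeriv hU) G) := by
  intro n x
  exact smoothDeriv_apply hU (h n) x

lemma coeff_evalAt (x : 𝕜) (G : GenSeries 𝕜 K) (e : Fin 2 →₀ ℕ) :
    coeff e (evalAt x G) = MvPowerSeries.map (Pi.evalRingHom (fun _ : 𝕜 => K) x) (coeff e G) :=
  coeff_map ..

lemma evalAt_neg (x : 𝕜) (G : GenSeries 𝕜 K) : evalAt x (-G) = -evalAt x G := map_neg _ _

lemma ext_of_map_evalSmooth {G H : MvPowerSeries Time (SmoothOn 𝕜 K U)}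
    (h : ∀ x, MvPowerSeries.map (evalSmooth x) G = MvPowerSeries.map (evalSmooth x) H) : G = H := by
  ext n x
  have := congrArg (coeff n) (h x)
  rwa [coeff_map, coeff_map] at this

lemma map_evalSmooth_smul (x : U) (q : ℚ) (G : MvPowerSeries Time (SmoothOn 𝕜 K U)) :
    MvPowerSeries.map (evalSmooth x) (q • G) = q • MvPowerSeries.map (evalSmooth x) G :=
  map_rat_smul _ _ _

/-- The unmixed Hirota equation, solved for the second derivatives. -/
lemma timeDeriv_timeDeriv_of_hirotaEq (hU : IsOpen U) {F : TimeSeries 𝕜 K}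
    {G : MvPowerSeries Time (SmoothOn 𝕜 K U)} (hFG : IsLift F G) (time : ℕ+ → Time)
    (h : ∀ x ∈ U, HirotaEq time F x) (i j : ℕ) :
    timeDeriv _ time j (timeDeriv _ time i G) = ∑ p ∈ posLists (i + j), T₂ i j p •
      (p.map fun s => coeffDeriv (smoothDeriv hU) (timeDeriv _ time s G)).prod := by
  apply ext_of_map_evalSmooth
  intro x
  rw [timeDeriv_comm]
  set a : ℕ → MvPowerSeries Time K := fun p =>
    MvPowerSeries.map (evalSmooth x) (coeffDeriv (smoothDeriv hU) (timeDeriv _ time p G)) with ha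
  have ha0 : a 0 = 0 := by
    simp [ha, timeDeriv_apply]
  have hA : ∀ s t : Fin 2, s ≠ t → ∀ e, coeff e (evalAt (x : 𝕜) (genD0 (genD time s (C F)))) =
      if e = Finsupp.single s (e s) then a (e s) else 0 := by
    intro s t hst e
    have h1 : coeff e (genD0 (genD time s (C F))) =
      if e t = 0 then d0 (timeDeriv (𝕜 → K) time (e s) F) else 0 := by
      change d0 (coeff e (genD time s (C F))) = _
      rw [coeff_genD_C _ hst]
      split_ifs
      · rfl
      · ext n y
        exact congrFun (deriv_const' (0 : K)) y
    have h2 : e = Finsupp.single s (e s) ↔ e t = 0 := by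
      constructor
      · intro h; rw [h, Finsupp.single_eq_of_ne hst.symm]
      · intro h; ext i
        by_cases hi : i = s
        · subst hi; simp
        · have : i = t := by omega
          subst this
          rw [h, Finsupp.single_eq_of_ne hst.symm]
    rw [coeff_evalAt, h1]
    simp only [h2]
    split_ifs
    · exact ((hFG.timeDeriv time (e s)).d0 hU).map_eq x
    · rw [map_zero]
  have hB : ∀ e, coeff e (evalAt (x : 𝕜) (genD time 0 (genD time 1 (C F)))) =
      MvPowerSeries.map (evalSmooth x) (timeDeriv _ time (e 0) (timeDeriv _ time (e 1) G)) := by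
    intro e
    rw [coeff_evalAt, coeff_genD_genD_C]
    exact ((hFG.timeDeriv time (e 1)).timeDeriv time (e 0)).map_eq x
  have hx := h x x.2
  unfold HirotaEq at hx
  simp only [evalAt_neg] at hx
  have hc0 : ∀ s t : Fin 2, s ≠ t →
      constantCoeff (-evalAt (x : 𝕜) (genD0 (genD time s (C F)))) = 0 := by
    intro s t hst
    rw [map_neg, ← coeff_zero_eq_constantCoeff_apply, hA s t hst]
    simp [ha0]
  have hB0 : constantCoeff (evalAt (x : 𝕜) (genD time 0 (genD time 1 (C F)))) = 0 := by
    rw [← coeff_zero_eq_constantCoeff_apply, hB]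
    simp [timeDeriv_apply]
  rw [gexp_eq_expSubst hB0, gexp_eq_expSubst (hc0 0 1 (by decide)),
    gexp_eq_expSubst (hc0 1 0 (by decide))] at hx
  have : IsDomain (MvPowerSeries Time K) := NoZeroDivisors.to_isDomain _
  have := coeff_eq_of_hirota ha0 (hA 0 1 (by decide)) (hA 1 0 (by decide)) hB0 hx
    (Finsupp.single 0 i + Finsupp.single 1 j)
  rw [hB] at this
  simp only [Finsupp.add_apply, Finsupp.single_eq_same,
    Finsupp.single_eq_of_ne (show (0 : Fin 2) ≠ 1 by decide),
    Finsupp.single_eq_of_ne (show (1 : Fin 2) ≠ 0 by decide), add_zero, zero_add] at this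
  rw [this, map_sum]
  refine Finset.sum_congr rfl fun p _ => ?_
  rw [map_evalSmooth_smul, map_list_prod, List.map_map]
  rfl

/-- The mixed Hirota equation on the line where all times vanish. -/
lemma constantCoeff_timeDeriv_timeDeriv_of_mixedHirotaEq (hU : IsOpen U) {F : TimeSeries 𝕜 K}
    {G : MvPowerSeries Time (SmoothOn 𝕜 K U)} (hFG : IsLift F G)
    (h : ∀ x ∈ U, MixedHirotaEq F x)
    (hsym : ∀ (time : ℕ+ → Time) i, constantCoeff (timeDeriv _ time i G) = 0)
    {f : SmoothOn 𝕜 K U} (hf : ∀ x, f.1 x = NormedSpace.exp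
      ((smoothDeriv (K := K) hU (smoothDeriv (K := K) hU (constantCoeff G))).1 x))
    {i j : ℕ} (hi : 0 < i) :
    constantCoeff (timeDeriv _ Sum.inl i (timeDeriv _ Sum.inr j G)) =
      if i = j then (i : ℚ)⁻¹ • f ^ i else 0 := by
  classical
  ext x
  set B := evalAt (x : 𝕜) (genD Sum.inl 0 (genD Sum.inr 1 (C F))) with hBdef
  have hB : ∀ e, coeff e B =
      MvPowerSeries.map (evalSmooth x)
        (timeDeriv _ Sum.inl (e 0) (timeDeriv _ Sum.inr (e 1) G)) := by
    intro e
    rw [coeff_evalAt, coeff_genD_genD_C]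
    exact ((hFG.timeDeriv Sum.inr (e 1)).timeDeriv Sum.inl (e 0)).map_eq x
  have hB0 : constantCoeff (-B) = 0 := by
    rw [map_neg, ← coeff_zero_eq_constantCoeff_apply, hB]
    simp [timeDeriv_apply]
  have hx := h x x.2
  unfold MixedHirotaEq at hx
  simp only [evalAt_neg] at hx
  rw [gexp_eq_expSubst hB0] at hx
  have hR : MvPowerSeries.map (constantCoeff (σ := Time) (R := K))
      (evalAt (x : 𝕜) (genD0 (genD0 (C F) + genD Sum.inl 0 (C F) + genD Sum.inr 1 (C F)))) =
      C ((smoothDeriv (K := K) hU (smoothDeriv (K := K) hU (constantCoeff G))).1 x) := by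
    ext e
    rw [coeff_map, coeff_evalAt, constantCoeff_map]
    change constantCoeff (d0 (coeff e (genD0 (C F) + genD Sum.inl 0 (C F) + genD Sum.inr 1 (C F))))
      (x : 𝕜) = _
    rw [map_add, map_add, coeff_genD_C _ (show (0 : Fin 2) ≠ 1 by decide),
      coeff_genD_C _ (show (1 : Fin 2) ≠ 0 by decide)]
    have hd : coeff e (genD0 (C F : GenSeries 𝕜 K)) = if e = 0 then d0 F else 0 := by
      change d0 (coeff e (C F)) = _
      rw [coeff_C]
      split_ifs
      · rfl
      · ext n y
        exact congrFun (deriv_const' (0 : K)) y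
    have hz : ∀ (time : ℕ+ → Time) (i : ℕ) (y : U),
        constantCoeff (timeDeriv (𝕜 → K) time i F) (y : 𝕜) = 0 := by
      intro time i y
      rw [← coeff_zero_eq_constantCoeff_apply, ← (hFG.timeDeriv time i) 0 y,
        coeff_zero_eq_constantCoeff_apply, hsym]
      rfl
    have hder : ∀ (Φ : TimeSeries 𝕜 K) (g : 𝕜 → K),
        (∀ y : U, constantCoeff Φ (y : 𝕜) = g y) →
        constantCoeff (d0 Φ) (x : 𝕜) = deriv g x := by
      intro Φ g hg
      rw [← coeff_zero_eq_constantCoeff_apply]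
      change deriv (coeff 0 Φ) (x : 𝕜) = _
      apply Filter.EventuallyEq.deriv_eq
      filter_upwards [hU.mem_nhds x.2] with y hy
      exact hg ⟨y, hy⟩
    rw [hd, coeff_C]
    rcases eq_or_ne e 0 with h0 | h0
    · rw [if_pos h0, if_pos h0, hder _ (constantCoeff (d0 F))]
      · symm
        refine smoothDeriv_apply hU (fun y => ?_) x
        exact (hFG.d0 hU) 0 y
      · intro y
        rw [map_add, map_add, Pi.add_apply, Pi.add_apply]
        split_ifs <;> simp [hz]
    · rw [if_neg h0, if_neg h0, hder _ 0]
      · exact congrFun (deriv_const' (0 : K)) _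
      · intro y
        rw [map_add, map_add, Pi.add_apply, Pi.add_apply]
        split_ifs <;> simp [hz]
  have hx' := congrArg (MvPowerSeries.map (constantCoeff (σ := Time) (R := K))) hx
  rw [map_sub, map_one, map_expSubst _ hB0, map_mul, map_mul, map_gexp hR, ← hf, map_X,
    map_X] at hx'
  -- setting the times to zero leaves `exp (-B) = 1 - u v f(x)`
  set H : MvPowerSeries (Fin 2) K := X 0 * X 1 * C (f.1 x) with hH
  have hHmon : H = monomial (Finsupp.single 0 1 + Finsupp.single 1 1) (f.1 x) := by
    rw [hH, X, X, monomial_mul_monomial, ← monomial_zero_eq_C_apply, monomial_mul_monomial,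
      add_zero, one_mul, one_mul]
  have hH0 : constantCoeff H = 0 := by simp [hH]
  have hC0 : constantCoeff (MvPowerSeries.map (constantCoeff (σ := Time) (R := K)) (-B)) = 0 := by
    rw [constantCoeff_map, hB0, map_zero]
  have key := coeff_eq_of_expSubst_eq_one_sub hC0 hH0 (by rw [← hx']; ring) (N := i + j)
    (e := Finsupp.single 0 i + Finsupp.single 1 j) (by rw [degree_fin_two]; simp)
  have hpow : ∀ k, coeff (Finsupp.single 0 i + Finsupp.single 1 j) (H ^ k) =
      if k = i ∧ k = j then f.1 x ^ k else 0 := by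
    intro k
    rw [hHmon, monomial_pow, coeff_monomial]
    congr 1
    rw [Finsupp.ext_iff, Fin.forall_fin_two]
    simp [eq_comm]
  rw [coeff_map, map_neg, map_neg, neg_inj, hB, constantCoeff_map] at key
  simp only [Finsupp.add_apply, Finsupp.single_eq_same,
    Finsupp.single_eq_of_ne (show (0 : Fin 2) ≠ 1 by decide),
    Finsupp.single_eq_of_ne (show (1 : Fin 2) ≠ 0 by decide), add_zero, zero_add] at key
  rw [evalSmooth_apply] at key
  rw [key]
  simp only [hpow]
  rw [Finset.sum_eq_single (i - 1)]
  · have h1 : i - 1 + 1 = i := by omega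
    rw [h1, Nat.cast_sub hi]
    simp only [true_and]
    split_ifs
    · simp
    · simp
  · intro k _ hk
    rw [if_neg (by omega), smul_zero]
  · intro h
    simp only [Finset.mem_range] at h
    omega

end Equations

/-! ### The Taylor coefficients -/

section Coefficients

open MvPowerSeries

lemma foldr_timeDeriv_smul {σ A : Type*} [CommRing A] [Algebra ℚ A] (time : ℕ+ → σ) (l : List ℕ+)
    (q : ℚ) (G : MvPowerSeries σ A) :
    (l.map PNat.val).foldr (fun i x => timeDeriv A time i x) (q • G) =
      ((((l.map PNat.val).prod : ℕ) : ℚ)⁻¹ * q) •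
        (l.map time).foldr (fun τ x => pderiv A τ x) G := by
  induction l with
  | nil => simp
  | cons k l ih =>
    have hk : k.val.toPNat' = k := PNat.coe_toPNat' k
    rw [List.map_cons, List.map_cons, List.foldr_cons, ih, List.foldr_cons, timeDeriv_apply,
      pderiv_smul_rat, smul_smul, hk, List.prod_cons, Nat.cast_mul, mul_inv, mul_assoc]

lemma prod_factorial_toFinsupp {A : Type*} [CommRing A] (Δ Δ' : Multiset ℕ+) :
    ((Multiset.toFinsupp (Δ.map Sum.inl + Δ'.map Sum.inr : Multiset Time)).prod
      fun _ n => (n.factorial : A)) = ((sigma Δ * sigma Δ' : ℕ) : A) := by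
  rw [Finsupp.prod_of_support_subset (s := Δ.toFinset.disjSum Δ'.toFinset), Finset.prod_disjSum,
    sigma, sigma, Nat.cast_mul, Nat.cast_prod, Nat.cast_prod]
  · congr 1 <;> refine Finset.prod_congr rfl fun k _ => ?_
    · rw [Multiset.toFinsupp_apply, Multiset.count_add,
        Multiset.count_map_eq_count' _ _ Sum.inl_injective,
        Multiset.count_eq_zero_of_notMem (a := Sum.inl k) (s := Δ'.map Sum.inr) (by simp), add_zero]
    · rw [Multiset.toFinsupp_apply, Multiset.count_add,
        Multiset.count_map_eq_count' _ _ Sum.inr_injective,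
        Multiset.count_eq_zero_of_notMem (a := Sum.inr k) (s := Δ.map Sum.inl) (by simp), zero_add]
  · intro τ
    rw [Multiset.toFinsupp_support, Multiset.mem_toFinset]
    rcases τ with k | k <;> simp
  · simp

lemma rows_eq_map_sort (Δ : Multiset ℕ+) : rows Δ = (Δ.sort (· ≥ ·)).map PNat.val := by
  simp only [rows, List.map_id', List.pure_def, List.bind_eq_flatMap, ← List.map_eq_flatMap]

lemma size_eq_sum_map (Δ : Multiset ℕ+) : size Δ = (Δ.map PNat.val).sum := by
  simp [size]

lemma rows_sum (Δ : Multiset ℕ+) : (rows Δ).sum = size Δ := by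
  rw [rows_eq_map_sort, size_eq_sum_map, ← Multiset.sum_coe, ← Multiset.map_coe, Multiset.sort_eq]

lemma rows_length (Δ : Multiset ℕ+) : (rows Δ).length = Multiset.card Δ := by
  rw [rows_eq_map_sort, List.length_map, Multiset.length_sort]

lemma rows_pos {Δ : Multiset ℕ+} : ∀ i ∈ rows Δ, 0 < i := by
  intro i hi
  rw [rows_eq_map_sort] at hi
  obtain ⟨k, -, rfl⟩ := List.mem_map.1 hi
  exact k.2

lemma rows_ne_nil {Δ : Multiset ℕ+} (h : Δ ≠ 0) : rows Δ ≠ [] := by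
  rw [← List.length_pos_iff_ne_nil, rows_length]
  exact Multiset.card_pos.2 h

lemma sigma_pos (Δ : Multiset ℕ+) : 0 < sigma Δ :=
  Finset.prod_pos fun _ _ => Nat.factorial_pos _

/-- A Taylor coefficient, expressed by the normalised derivatives `E_n = (1/n) ∂_n`. -/
lemma prod_smul_constantCoeff_foldr {A : Type*} [CommRing A] [Algebra ℚ A] (Δ Δ' : Multiset ℕ+)
    (G : MvPowerSeries Time A) :
    (((rows Δ).prod * (rows Δ').prod : ℕ) : ℚ) •
        constantCoeff ((rows Δ').foldr (fun j x => timeDeriv A Sum.inr j x)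
          ((rows Δ).reverse.foldr (fun i x => timeDeriv A Sum.inl i x) G)) =
      ((sigma Δ * sigma Δ' : ℕ) : ℚ) •
        coeff (Multiset.toFinsupp (Δ.map Sum.inl + Δ'.map Sum.inr)) G := by
  have hl := foldr_timeDeriv_smul (Sum.inl : ℕ+ → Time) (Δ.sort (· ≥ ·)).reverse 1 G
  rw [one_smul, List.map_reverse, ← rows_eq_map_sort] at hl
  rw [hl, rows_eq_map_sort Δ', foldr_timeDeriv_smul, ← rows_eq_map_sort,
    ← List.foldr_append, mul_one, List.prod_reverse,
    ← coeff_zero_eq_constantCoeff_apply]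
  have h0 : ∀ Δ : Multiset ℕ+, ((rows Δ).prod : ℚ) ≠ 0 := fun Δ => by
    exact_mod_cast (List.prod_pos rows_pos).ne'
  have h1 : (((Δ'.sort (· ≥ ·)).map Sum.inr ++ (Δ.sort (· ≥ ·)).reverse.map Sum.inl :
      List Time) : Multiset Time) = Δ.map Sum.inl + Δ'.map Sum.inr := by
    rw [← Multiset.coe_add, ← Multiset.map_coe, ← Multiset.map_coe, Multiset.coe_reverse,
      Multiset.sort_eq, Multiset.sort_eq, add_comm]
  rw [coeff_zero_eq_constantCoeff_apply]
  have h2 : ∀ (q : ℚ) (H : MvPowerSeries Time A),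
      constantCoeff (q • H) = q • constantCoeff H := fun q H => map_rat_smul _ _ _
  rw [h2, smul_smul, constantCoeff_foldr_pderiv, h1, prod_factorial_toFinsupp]
  have h3 : (((rows Δ).prod * (rows Δ').prod : ℕ) : ℚ) *
      (((rows Δ').prod : ℚ)⁻¹ * ((rows Δ).prod : ℚ)⁻¹) = 1 := by
    have := h0 Δ
    have := h0 Δ'
    rw [Nat.cast_mul]
    field_simp
  rw [h3, one_smul, Algebra.smul_def, map_natCast]

/-- The constant coefficient as a homomorphism of `ℚ`-algebras. -/
noncomputable def constantCoeffHom (σ A : Type*) [CommRing A] [Algebra ℚ A] :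
    MvPowerSeries σ A →ₐ[ℚ] A :=
  { constantCoeff (σ := σ) (R := A) with
    commutes' := fun q => by
      change constantCoeff (algebraMap ℚ _ q) = _
      simp }

/-- The Taylor coefficients of a series over a differential ring whose second derivatives satisfy
the relations of the hierarchy. -/
lemma sigma_smul_coeff_eq_sum {A : Type*} [CommRing A] [Algebra ℚ A] (δ : Derivation ℚ A A)
    (G : MvPowerSeries Time A) (f : A)
    (hE : ∀ (time : ℕ+ → Time), time = Sum.inl ∨ time = Sum.inr → ∀ i j,
      timeDeriv A time j (timeDeriv A time i G) = ∑ p ∈ posLists (i + j), T₂ i j p •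
        (p.map fun s => coeffDeriv δ (timeDeriv A time s G)).prod)
    (hmix : ∀ i j, 0 < i →
      constantCoeff (timeDeriv A Sum.inl i (timeDeriv A Sum.inr j G)) =
        if i = j then (i : ℚ)⁻¹ • f ^ i else 0)
    (hsym : ∀ (time : ℕ+ → Time) i, constantCoeff (timeDeriv A time i G) = 0)
    {Δ : Multiset ℕ+} (hΔ : Δ ≠ 0) (Δ' : Multiset ℕ+) :
    ((sigma Δ * sigma Δ' : ℕ) : ℚ) •
        coeff (Multiset.toFinsupp (Δ.map Sum.inl + Δ'.map Sum.inr)) G =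
      ∑ c : Composition (rows Δ).sum,
        ∑ r ∈ Finset.Nat.antidiagonalTuple c.length ((rows Δ).length + (rows Δ').length - 2),
          NTilde (rows Δ) (rows Δ') c.blocksFun r • ∏ a, δ^[r a] (f ^ c.blocksFun a) := by
  rw [← prod_smul_constantCoeff_foldr]
  exact ev_foldr_foldr (ev := constantCoeffHom Time A)
    (d := coeffDeriv δ) (δ := δ) (E := timeDeriv A Sum.inl)
    (E' := timeDeriv A Sum.inr) (F := G) (f := f)
    (fun x => rfl) (fun i x => timeDeriv_coeffDeriv _ _ i x)
    (fun i x => timeDeriv_coeffDeriv _ _ i x) (fun i j x => timeDeriv_comm _ _ i j x)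
    (fun i j _ _ => hE _ (Or.inl rfl) i j) (fun i j _ _ => hE _ (Or.inr rfl) i j)
    (fun i j hi _ => hmix i j hi) (fun i => hsym _ i) (fun i => hsym _ i)
    (rows_ne_nil hΔ) rows_pos rows_pos

/-- The coefficients without unbarred times vanish: expand the barred derivatives alone. -/
lemma coeff_map_inr_eq_zero {A : Type*} [CommRing A] [Algebra ℚ A] (δ : Derivation ℚ A A)
    (G : MvPowerSeries Time A)
    (hE : ∀ i j, timeDeriv A Sum.inr j (timeDeriv A Sum.inr i G) =
      ∑ p ∈ posLists (i + j), T₂ i j p •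
        (p.map fun s => coeffDeriv δ (timeDeriv A Sum.inr s G)).prod)
    (hsym : ∀ i, constantCoeff (timeDeriv A Sum.inr i G) = 0)
    {Δ' : Multiset ℕ+} (hΔ' : Δ' ≠ 0) :
    coeff (Multiset.toFinsupp
      ((0 : Multiset ℕ+).map Sum.inl + Δ'.map Sum.inr : Multiset Time)) G = 0 := by
  have h := prod_smul_constantCoeff_foldr 0 Δ' G
  have h0 : ((sigma 0 * sigma Δ' : ℕ) : ℚ) ≠ 0 := by
    exact_mod_cast (Nat.mul_pos (sigma_pos 0) (sigma_pos Δ')).ne'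
  have hr : rows 0 = [] := by simp [rows]
  rw [hr, List.reverse_nil, List.foldr_nil,
    foldr_eq_sum_TRev (d := coeffDeriv δ) (E := timeDeriv A Sum.inr)
      (F := G) (fun i x => timeDeriv_coeffDeriv _ _ i x)
      (fun i j _ _ => hE i j) _ (rows_ne_nil hΔ') rows_pos, map_sum,
    Finset.sum_eq_zero, smul_zero] at h
  · rw [← inv_smul_smul₀ h0 (coeff _ G), ← h, smul_zero]
  · intro L hL
    have hne : L ≠ [] := by
      rintro rfl
      have h1 := (mem_colLists.1 hL).2
      have h2 := List.sum_pos _ (rows_pos (Δ := Δ')) (rows_ne_nil hΔ')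
      rw [← h1] at h2
      exact absurd h2 (lt_irrefl 0)
    obtain ⟨q, L, rfl⟩ := List.exists_cons_of_ne_nil hne
    have hq : constantCoeff (colVal (coeffDeriv δ) (timeDeriv A Sum.inr) G q) = 0 := by
      rw [colVal]
      have := comp_iterate (ev := constantCoeffHom Time A)
        (d := coeffDeriv δ) (δ := δ) (fun x => rfl) q.2
        (timeDeriv A Sum.inr q.1 G)
      change constantCoeff _ = δ^[q.2] (constantCoeff _) at this
      rw [this, hsym, iterate_map_zero]
    rw [map_rat_smul, List.map_cons, List.prod_cons, map_mul, hq, zero_mul, smul_zero]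

variable {𝕜 K : Type*} [RCLike 𝕜] [RCLike K] [NormedAlgebra 𝕜 K] {U : Set 𝕜} {F : TimeSeries 𝕜 K}

/-- A formal solution as a power series over the ring of smooth functions on `U`. -/
noncomputable def smoothLift (hF : IsFormalSolution U F) :
    MvPowerSeries Time (SmoothOn 𝕜 K U) :=
  fun n => ⟨fun x => coeff n F x, coeff n F, by
    obtain ⟨s, rfl⟩ := Multiset.toFinsupp.surjective n
    have hs : s = (s.filterMap Sum.getLeft?).map Sum.inl +
        (s.filterMap Sum.getRight?).map Sum.inr := by
      induction s using Multiset.induction_on with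
      | empty => rfl
      | cons τ s ih =>
        rcases τ with k | k
        · rw [Multiset.filterMap_cons_some Sum.getLeft? (Sum.inl k) s rfl,
            Multiset.filterMap_cons_none (f := Sum.getRight?) (Sum.inl k) s rfl,
            Multiset.map_cons, Multiset.cons_add, ← ih]
        · rw [Multiset.filterMap_cons_some Sum.getRight? (Sum.inr k) s rfl,
            Multiset.filterMap_cons_none (f := Sum.getLeft?) (Sum.inr k) s rfl,
            Multiset.map_cons, Multiset.add_cons, ← ih]
    rw [hs]
    exact hF.1 _ _, fun _ => rfl⟩

lemma isLift_smoothLift (hF : IsFormalSolution U F) : IsLift F (smoothLift hF) :=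
  fun _ _ => rfl

lemma constantCoeff_timeDeriv_eq_zero (hF : IsSymmetricSolution U F) (time : ℕ+ → Time) (i : ℕ) :
    constantCoeff (timeDeriv _ time i (smoothLift hF.1)) = 0 := by
  ext x
  rw [← coeff_zero_eq_constantCoeff_apply, ((isLift_smoothLift hF.1).timeDeriv time i) 0 x]
  change (i : ℚ)⁻¹ • (constantCoeff (dt (time i.toPNat') F) : 𝕜 → K) x = 0
  rw [hF.2 x x.2, smul_zero]

/-- The function `f = exp(F'')` on the line where all times vanish. -/
noncomputable def expSecondDeriv (hF : IsFormalSolution U F) (hU : IsOpen U) : SmoothOn 𝕜 K U :=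
  ⟨fun x => NormedSpace.exp (iteratedDeriv 2 (coeffAt F 0 0) x),
    fun x => NormedSpace.exp (iteratedDeriv 2 (coeffAt F 0 0) x), by
      have h1 := ((contDiffOn_infty_iff_deriv_of_isOpen hU).1 (hF.1 0 0)).2
      have h2 := ((contDiffOn_infty_iff_deriv_of_isOpen hU).1 h1).2
      have h3 : ContDiff 𝕜 ∞ (NormedSpace.exp : K → K) :=
        contDiff_iff_contDiffAt.2 fun x => (NormedSpace.exp_analytic (𝕂 := 𝕜) x).contDiffAt
      rw [iteratedDeriv_succ, iteratedDeriv_one]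
      exact h3.comp_contDiffOn h2, fun _ => rfl⟩

lemma expSecondDeriv_apply (hF : IsFormalSolution U F) (hU : IsOpen U) (x : U) :
    (expSecondDeriv hF hU).1 x = NormedSpace.exp ((smoothDeriv (K := K) hU
      (smoothDeriv (K := K) hU (constantCoeff (smoothLift hF)))).1 x) := by
  have h : ∀ y : U, (constantCoeff (smoothLift hF)).1 y = coeffAt F 0 0 y := by
    intro y
    rw [coeffAt, ← coeff_zero_eq_constantCoeff_apply]
    rfl
  have := iterate_smoothDeriv_apply hU h 2 x
  change NormedSpace.exp _ = _
  rw [← this]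
  rfl

lemma coeff_smoothLift_eq_sum (hU : IsOpen U) (hF : IsSymmetricSolution U F)
    {Δ : Multiset ℕ+} (hΔ : Δ ≠ 0) (Δ' : Multiset ℕ+) :
    coeff (Multiset.toFinsupp (Δ.map Sum.inl + Δ'.map Sum.inr)) (smoothLift hF.1) =
      ∑ c : Composition (size Δ),
        ∑ r ∈ Finset.Nat.antidiagonalTuple c.length (Multiset.card Δ + Multiset.card Δ' - 2),
          N Δ Δ' c.blocksFun r •
            ∏ a, (smoothDeriv (K := K) hU)^[r a] (expSecondDeriv hF.1 hU ^ c.blocksFun a) := by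
  have hl := isLift_smoothLift hF.1
  have h := sigma_smul_coeff_eq_sum (A := SmoothOn 𝕜 K U) (smoothDeriv hU) (smoothLift hF.1)
    (expSecondDeriv hF.1 hU)
    (fun time ht i j => timeDeriv_timeDeriv_of_hirotaEq hU hl time (fun x hx => by
      rcases ht with rfl | rfl
      exacts [(hF.1.2 x hx).1, (hF.1.2 x hx).2.1]) i j)
    (fun i j hi => constantCoeff_timeDeriv_timeDeriv_of_mixedHirotaEq hU hl
      (fun x hx => (hF.1.2 x hx).2.2) (constantCoeff_timeDeriv_eq_zero hF)
      (expSecondDeriv_apply hF.1 hU) hi)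
    (constantCoeff_timeDeriv_eq_zero hF) hΔ Δ'
  rw [rows_length, rows_length, rows_sum] at h
  have h0 : ((sigma Δ * sigma Δ' : ℕ) : ℚ) ≠ 0 := by
    exact_mod_cast (Nat.mul_pos (sigma_pos Δ) (sigma_pos Δ')).ne'
  rw [← inv_smul_smul₀ h0 (coeff _ _), h]
  simp only [Finset.smul_sum, smul_smul, N, one_div, Nat.cast_mul]

lemma coeffAt_eq_taylorCoeff (hU : IsOpen U) (hF : IsSymmetricSolution U F)
    {Δ : Multiset ℕ+} (hΔ : Δ ≠ 0) (Δ' : Multiset ℕ+) {x : 𝕜} (hx : x ∈ U) :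
    coeffAt F Δ Δ' x =
      taylorCoeff (fun y => NormedSpace.exp (iteratedDeriv 2 (coeffAt F 0 0) y)) Δ Δ' x := by
  have h := congrArg (evalSmooth (⟨x, hx⟩ : U)) (coeff_smoothLift_eq_sum hU hF hΔ Δ')
  change coeffAt F Δ Δ' x = _ at h
  rw [h, taylorCoeff, map_sum]
  refine Finset.sum_congr rfl fun c _ => ?_
  rw [map_sum]
  refine Finset.sum_congr rfl fun r _ => ?_
  rw [map_rat_smul, map_prod, Algebra.smul_def, eq_ratCast]
  congr 1
  refine Finset.prod_congr rfl fun a _ => ?_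
  exact iterate_smoothDeriv_apply hU (fun _ => rfl) (r a) ⟨x, hx⟩

lemma taylorCoeff_eq_zero (f : 𝕜 → K) {Δ Δ' : Multiset ℕ+} (h : size Δ ≠ size Δ') (x : 𝕜) :
    taylorCoeff f Δ Δ' x = 0 := by
  refine Finset.sum_eq_zero fun c _ => Finset.sum_eq_zero fun r _ => ?_
  rw [N, NTilde_eq_zero, mul_zero, Rat.cast_zero, zero_mul]
  rwa [c.sum_blocksFun, rows_sum]

lemma coeffAt_zero_left (hU : IsOpen U) (hF : IsSymmetricSolution U F)
    {Δ' : Multiset ℕ+} (hΔ' : Δ' ≠ 0) {x : 𝕜} (hx : x ∈ U) : coeffAt F 0 Δ' x = 0 := by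
  have h := coeff_map_inr_eq_zero (A := SmoothOn 𝕜 K U) (smoothDeriv hU) (smoothLift hF.1)
    (fun i j => timeDeriv_timeDeriv_of_hirotaEq hU (isLift_smoothLift hF.1) _
      (fun x hx => (hF.1.2 x hx).2.1) i j)
    (constantCoeff_timeDeriv_eq_zero hF Sum.inr) hΔ'
  exact congrFun (congrArg Subtype.val h) ⟨x, hx⟩

lemma coeffAt_eq_zero (hU : IsOpen U) (hF : IsSymmetricSolution U F)
    {Δ Δ' : Multiset ℕ+} (h : size Δ ≠ size Δ') {x : 𝕜} (hx : x ∈ U) : coeffAt F Δ Δ' x = 0 := by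
  rcases eq_or_ne Δ 0 with rfl | hΔ
  · refine coeffAt_zero_left hU hF ?_ hx
    rintro rfl
    exact h rfl
  · rw [coeffAt_eq_taylorCoeff hU hF hΔ Δ' hx, taylorCoeff_eq_zero _ h]

lemma taylorCoeff_congr (hU : IsOpen U) {f g : 𝕜 → K} (h : Set.EqOn f g U) (Δ Δ' : Multiset ℕ+)
    {x : 𝕜} (hx : x ∈ U) : taylorCoeff f Δ Δ' x = taylorCoeff g Δ Δ' x := by
  refine Finset.sum_congr rfl fun c _ => Finset.sum_congr rfl fun r _ => ?_
  congr 1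
  refine Finset.prod_congr rfl fun a _ => ?_
  refine Filter.EventuallyEq.iteratedDeriv_eq _ ?_
  filter_upwards [hU.mem_nhds hx] with y hy
  rw [h hy]

end Coefficients

end Toda

theorem theorem2p1 {𝕜 K : Type*} [RCLike 𝕜] [RCLike K] [NormedAlgebra 𝕜 K]
    (U : Set 𝕜) (hU : IsOpen U) :
    (∀ F : Toda.TimeSeries 𝕜 K, Toda.IsSymmetricSolution U F →
      ∀ Δ Δ' : Multiset ℕ+, ∀ x ∈ U,
        (Toda.size Δ ≠ Toda.size Δ' → Toda.coeffAt F Δ Δ' x = 0) ∧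
        (Δ ≠ 0 → Toda.size Δ = Toda.size Δ' →
          Toda.coeffAt F Δ Δ' x =
            Toda.taylorCoeff
              (fun y => NormedSpace.exp (iteratedDeriv 2 (Toda.coeffAt F 0 0) y)) Δ Δ' x)) ∧
    (∀ F G : Toda.TimeSeries 𝕜 K, Toda.IsSymmetricSolution U F → Toda.IsSymmetricSolution U G →
      Set.EqOn (Toda.coeffAt F 0 0) (Toda.coeffAt G 0 0) U →
        ∀ Δ Δ' : Multiset ℕ+, Set.EqOn (Toda.coeffAt F Δ Δ') (Toda.coeffAt G Δ Δ') U) := by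
  refine ⟨fun F hF Δ Δ' x hx => ⟨fun h => Toda.coeffAt_eq_zero hU hF h hx,
    fun hΔ _ => Toda.coeffAt_eq_taylorCoeff hU hF hΔ Δ' hx⟩, fun F G hF hG h Δ Δ' x hx => ?_⟩
  rcases eq_or_ne Δ 0 with rfl | hΔ
  · rcases eq_or_ne Δ' 0 with rfl | hΔ'
    · exact h hx
    · rw [Toda.coeffAt_zero_left hU hF hΔ' hx, Toda.coeffAt_zero_left hU hG hΔ' hx]
  · rw [Toda.coeffAt_eq_taylorCoeff hU hF hΔ Δ' hx, Toda.coeffAt_eq_taylorCoeff hU hG hΔ Δ' hx]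
    refine Toda.taylorCoeff_congr hU (fun y hy => ?_) Δ Δ' hx
    have : Toda.coeffAt F 0 0 =ᶠ[nhds y] Toda.coeffAt G 0 0 := by
      filter_upwards [hU.mem_nhds hy] with z hz using h hz
    simp only [this.iteratedDeriv_eq 2]
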